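/- **Setting.** Let $\mathfrak A$ be a unital complex $*$-algebra with a state $\langle\cdot\rangle$, let $\iota_x$ and $\tau_t$ ($x,t\in\mathbb R$) be commuting one-parameter groups of $*$-automorphisms (space and time translations) that leave the state invariant, and let $\mathcal V\subset\mathfrak A$ be a $\iota$-invariant $*$-subalgebra (local observables). Write $a(x,t)=\iota_x\tau_t a$, and let $\langle\cdots\rangle^{\rm c}$ denote connected correlation functions (joint cumulants, with operator order kept). Assume that all multi-point functions are continuous in their space-time arguments, and that for $a,b\in\mathcal V$ and $t\in\mathbb R$ one has $|\langle a(x,t)b\rangle^{\rm c}|\le C(1+|x|)^{-d}$ for some $C$ and some $d>1$. Let $\mathcal H'$ be the Hilbert space obtained from the span of the time translates of $\mathcal V$ with the semi-inner product $\langle a,b\rangle_{\mathcal H'}=\int dx\,\langle a(x)^\dagger b\rangle^{\rm c}$ (divide by null elements and complete); $\tau_t$ acts unitarily on it. Let $\mathbb P_\tau$ be the orthogonal projection onto the ballistic space $\bigcap_t\ker(\tau_t-1)\subset\mathcal H'$. **Exponents.** For $\psi\in\mathcal H'$ and $u\in(1,2)$ put $$\|\psi\|^-_{u}=\Big[(3-u)\liminf_{T\to\infty}(2T)^{u-3}\Big\|\int_{-T}^{T}dt\,(1-\mathbb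 P_\tau)\tau_t\psi\Big\|^2_{\mathcal H'}\Big]^{1/2}\in[0,\infty].$$ For $\alpha\in(1/2,1)$, $\psi$ has *normal superdiffusion exponent* $\alpha$ if, for $u\in(1,2)$, $\|\psi\|_u^-=0$ when $u<3-2\alpha$ and $\|\psi\|_u^-=\infty$ when $u>3-2\alpha$; it has *fat superdiffusion exponent* $\alpha$ if the same holds with $1/\alpha$ in place of $3-2\alpha$. **Normal modes.** Let $q_I\in\mathcal V$ be self-adjoint densities with $\langle q_I\rangle=0$, and $j_I\in\mathcal V$ self-adjoint currents, such that $\partial_tq_I(x,t)+\partial_xj_I(x,t)=0$ holds inside correlation functions (in integrated form), the classes of the $q_I$ form an orthonormal basis of the ballistic space, and $\langle q_I,j_K\rangle_{\mathcal H'}=v_I\,\delta_{IK}$ with $v_I\in\mathbb R$. Then $(1-\mathbb P_\tau)j_K$ is represented by the local observable $j_K-v_Kq_K$. Put $$\langle Q_I^2(1-\mathbb P_\tau)j_K\rangle^{\rm c}=\int_{\mathbb R^2} dy_1\,dy_2\,\langle q_I(y_1)\,q_I(y_2)\,(j_K-v_Kq_K)\rangle^{\rm c}.$$ **Clustering.**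 (i) There are $v>0$ and $p>3$ such that, for $n=2,3,4$ and $a_1,\dots,a_n\in\mathcal V$, there is a constant $C$ with $|\langle a_1(x_1,t_1)\cdots a_n(x_n,t_n)\rangle^{\rm c}|\le C(1+D)^{-p}$ whenever $D\ge0$ and the points split into two nonempty groups such that $|x_i-x_j|\ge D$ and $|x_i-x_j|\ge v|t_i-t_j|$ for all $i,j$ in different groups. (ii) For modes $I,K$ and a number $\alpha_I\in(1/2,1)$: for every $u\in(\alpha_I+1,2)$ there are $\kappa,R>0$, a constant $C$ and a finite set $F\subset[-1,\infty)$ such that for $|t|\ge R$, $|x-y_1|,|x-y_2|\le v|t|$, and either $i\in\{1,2\}$ with $|x-y_i-v_It|\ge|\kappa t|^{u-1}$, $$\big|\langle\big((1-\mathbb P_\tau)j_K\big)(x,t)\,q_I(y_1,0)\,q_I(y_2,0)\rangle^{\rm c}\big|\le C\sum_{\nu\in F}|t|^{-\nu}\,|x-y_i-v_It|^{\nu-1/\alpha_I-1}.$$ **Theorem.** Assume (i), and let $I$ be a mode and $\alpha_I\in(1/2,1)$. A. If (ii) holds with $K=I$, if $\langle Q_I^2(1-\mathbb P_\tau)j_I\rangle^{\rm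 c}\ne0$, and if $j_I$ has normal (resp. fat) superdiffusion exponent $\alpha_I$, then $\alpha_I\ge\frac23$ (resp. $\alpha_I\ge\frac{2}{\sqrt5+1}$). B. Let $K$ be any mode. If (ii) holds for $I,K$, if $\langle Q_I^2(1-\mathbb P_\tau)j_K\rangle^{\rm c}\ne0$, and if $j_K$ has normal (resp. fat) superdiffusion exponent $\alpha_K$, then $\alpha_K\ge1-\frac{\alpha_I}{2}$ (resp. $\alpha_K\ge\frac{1}{\alpha_I+1}$). -/

import Mathlib

open MeasureTheory Filter Topology Set
open scoped InnerProductSpace ENNReal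

noncomputable section

/-- A homogeneous, stationary state of a one-dimensional many-body system: a unital complex
`*`-algebra of observables `𝔄` with a state `ω`, commuting groups of space translations `ι x` and
time translations `τ t` that leave `ω` invariant, and a translation-invariant `*`-subalgebra `V` of
local observables.  Multi-point functions are continuous, and covariances of local observables,
possibly at different times, decay in space fast enough to be integrable. -/
structure ManyBodySystem (𝔄 : Type*) [Ring 𝔄] [StarRing 𝔄] [Algebra ℂ 𝔄] [StarModule ℂ 𝔄] where
  /-- the state -/
  ω : 𝔄 →ₗ[ℂ] ℂ
  ω_one : ω 1 = 1
  ω_star : ∀ a, ω (star a) = star (ω a)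
  ω_nonneg : ∀ a, 0 ≤ (ω (star a * a)).re
  /-- space translations -/
  ι : ℝ → 𝔄 ≃⋆ₐ[ℂ] 𝔄
  /-- time translations -/
  τ : ℝ → 𝔄 ≃⋆ₐ[ℂ] 𝔄
  ι_add : ∀ x y a, ι (x + y) a = ι x (ι y a)
  τ_add : ∀ s t a, τ (s + t) a = τ s (τ t a)
  ι_τ_comm : ∀ x t a, ι x (τ t a) = τ t (ι x a)
  ω_ι : ∀ x a, ω (ι x a) = ω a
  ω_τ : ∀ t a, ω (τ t a) = ω a
  /-- the local observables -/
  V : StarSubalgebra ℂ 𝔄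
  ι_mem : ∀ x, ∀ a ∈ V, ι x a ∈ V
  continuous_corr : ∀ (n : ℕ) (a : Fin n → 𝔄), Continuous fun z : Fin n → ℝ × ℝ =>
    ω (List.ofFn fun i => ι (z i).1 (τ (z i).2 (a i))).prod
  decay : ∀ a ∈ V, ∀ b ∈ V, ∀ t : ℝ, ∃ C d : ℝ, 1 < d ∧ ∀ x : ℝ,
    ‖ω (ι x (τ t a) * b) - ω a * ω b‖ ≤ C * (1 + |x|) ^ (-d)

namespace ManyBodySystem

variable {𝔄 : Type*} [Ring 𝔄] [StarRing 𝔄] [Algebra ℂ 𝔄] [StarModule ℂ 𝔄]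

section Correlations

variable (S : ManyBodySystem 𝔄)

/-- The translated observable `a(x,t)`. -/
def shift (x t : ℝ) (a : 𝔄) : 𝔄 := S.ι x (S.τ t a)

/-- Connected two-point function `⟨a b⟩ᶜ`. -/
def conn2 (a b : 𝔄) : ℂ := S.ω (a * b) - S.ω a * S.ω b

/-- Connected three-point function `⟨a b c⟩ᶜ` (the third joint cumulant, operator order kept). -/
def conn3 (a b c : 𝔄) : ℂ :=
  S.ω (a * b * c) - S.ω (a * b) * S.ω c - S.ω (a * c) * S.ω b - S.ω (b * c) * S.ω a
    + 2 * (S.ω a * S.ω b * S.ω c)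

/-- Connected four-point function `⟨a b c d⟩ᶜ` (the fourth joint cumulant, operator order kept). -/
def conn4 (a b c d : 𝔄) : ℂ :=
  S.ω (a * b * c * d)
    - S.ω (a * b * c) * S.ω d - S.ω (a * b * d) * S.ω c
    - S.ω (a * c * d) * S.ω b - S.ω (b * c * d) * S.ω a
    - S.ω (a * b) * S.ω (c * d) - S.ω (a * c) * S.ω (b * d) - S.ω (a * d) * S.ω (b * c)
    + 2 * (S.ω (a * b) * S.ω c * S.ω d + S.ω (a * c) * S.ω b * S.ω d
      + S.ω (a * d) * S.ω b * S.ω c + S.ω (b * c) * S.ω a * S.ω d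
      + S.ω (b * d) * S.ω a * S.ω c + S.ω (c * d) * S.ω a * S.ω b)
    - 6 * (S.ω a * S.ω b * S.ω c * S.ω d)

/-- Clustering of an `n`-point function `κ` of local observables outside the cone of velocity `v`,
with power `p`, uniformly in space-time: if the points split into two nonempty groups such that any
two points from different groups satisfy `|xᵢ - xⱼ| ≥ v |tᵢ - tⱼ|` and `|xᵢ - xⱼ| ≥ D`, then `κ` is
bounded by a constant times `(1 + D) ^ (-p)`. -/
def ClustersWith (v p : ℝ) (n : ℕ) (κ : (Fin n → 𝔄) → ℂ) : Prop :=
  ∀ a : Fin n → 𝔄, (∀ i, a i ∈ S.V) → ∃ C : ℝ, ∀ (x t : Fin n → ℝ) (A : Set (Fin n)) (D : ℝ),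
    A.Nonempty → Aᶜ.Nonempty → 0 ≤ D →
    (∀ i ∈ A, ∀ j ∈ Aᶜ, D ≤ |x i - x j| ∧ v * |t i - t j| ≤ |x i - x j|) →
    ‖κ fun i => S.shift (x i) (t i) (a i)‖ ≤ C * (1 + D) ^ (-p)

/-- Lieb-Robinson-type clustering of the connected two-, three- and four-point functions. -/
def Clustering (v p : ℝ) : Prop :=
  S.ClustersWith v p 2 (fun a => S.conn2 (a 0) (a 1)) ∧
  S.ClustersWith v p 3 (fun a => S.conn3 (a 0) (a 1) (a 2)) ∧
  S.ClustersWith v p 4 (fun a => S.conn4 (a 0) (a 1) (a 2) (a 3))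

/-- The space-integrated covariance `∫ dx ⟨a(x)† b⟩ᶜ`. -/
def hydroForm (a b : 𝔄) : ℂ := ∫ x : ℝ, S.conn2 (star (S.ι x a)) b

/-- The linear span of all time translates of local observables. -/
def nucleus : Submodule ℂ 𝔄 := Submodule.span ℂ {b | ∃ t : ℝ, ∃ a ∈ S.V, b = S.τ t a}

end Correlations

section HydroSpace

variable (S : ManyBodySystem 𝔄)

lemma ι_zero (a : 𝔄) : S.ι 0 a = a := by
  have h := S.ι_add 0 0 a
  rw [add_zero] at h
  exact ((S.ι 0).injective h).symm

lemma τ_zero (a : 𝔄) : S.τ 0 a = a := by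
  have h := S.τ_add 0 0 a
  rw [add_zero] at h
  exact ((S.τ 0).injective h).symm

lemma mem_nucleus {a : 𝔄} (ha : a ∈ S.V) : a ∈ S.nucleus :=
  Submodule.subset_span ⟨0, a, ha, (S.τ_zero a).symm⟩

lemma τ_mem_nucleus (t : ℝ) {a : 𝔄} (ha : a ∈ S.nucleus) : S.τ t a ∈ S.nucleus := by
  induction ha using Submodule.span_induction with
  | mem x hx =>
    obtain ⟨s, a, ha, rfl⟩ := hx
    exact Submodule.subset_span ⟨t + s, a, ha, (S.τ_add t s a).symm⟩
  | zero => simp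
  | add x y _ _ hx hy => rw [map_add]; exact add_mem hx hy
  | smul c x _ hx => rw [map_smul]; exact Submodule.smul_mem _ _ hx

lemma conn2_star_eq (x : ℝ) (a b : 𝔄) :
    S.conn2 (star (S.ι x a)) b = S.ω (star (S.ι x a) * b) - star (S.ω a) * S.ω b := by
  rw [conn2, S.ω_star, S.ω_ι]

lemma exists_decay {a b : 𝔄} (ha : a ∈ S.nucleus) (hb : b ∈ S.nucleus) :
    ∃ C d : ℝ, 1 < d ∧ ∀ x : ℝ,
      ‖S.conn2 (star (S.ι x a)) b‖ ≤ C * (1 + |x|) ^ (-d) := by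
  have key : ∀ f g h : ℝ → ℂ, (∀ x, ‖h x‖ ≤ ‖f x‖ + ‖g x‖) →
      (∃ C d : ℝ, 1 < d ∧ ∀ x : ℝ, ‖f x‖ ≤ C * (1 + |x|) ^ (-d)) →
      (∃ C d : ℝ, 1 < d ∧ ∀ x : ℝ, ‖g x‖ ≤ C * (1 + |x|) ^ (-d)) →
      ∃ C d : ℝ, 1 < d ∧ ∀ x : ℝ, ‖h x‖ ≤ C * (1 + |x|) ^ (-d) := by
    rintro f g h hfg ⟨C₁, d₁, h₁, H₁⟩ ⟨C₂, d₂, h₂, H₂⟩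
    have aux : ∀ (C d : ℝ) (x : ℝ), min d₁ d₂ ≤ d →
        C * (1 + |x|) ^ (-d) ≤ |C| * (1 + |x|) ^ (-(min d₁ d₂)) := by
      intro C d x hd
      have h1 : (1 : ℝ) ≤ 1 + |x| := by linarith [abs_nonneg x]
      have h2 : (1 + |x|) ^ (-d) ≤ (1 + |x|) ^ (-(min d₁ d₂)) :=
        Real.rpow_le_rpow_of_exponent_le h1 (by linarith)
      have h3 : 0 ≤ (1 + |x|) ^ (-d) := by positivity
      exact mul_le_mul (le_abs_self C) h2 h3 (abs_nonneg C)
    refine ⟨|C₁| + |C₂|, min d₁ d₂, lt_min h₁ h₂, fun x => ?_⟩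
    have h1 := aux C₁ d₁ x (min_le_left _ _)
    have h2 := aux C₂ d₂ x (min_le_right _ _)
    have h3 := hfg x
    have h4 := H₁ x
    have h5 := H₂ x
    rw [add_mul]
    linarith
  have key2 : ∀ (c : ℂ) (f h : ℝ → ℂ), (∀ x, ‖h x‖ = ‖c‖ * ‖f x‖) →
      (∃ C d : ℝ, 1 < d ∧ ∀ x : ℝ, ‖f x‖ ≤ C * (1 + |x|) ^ (-d)) →
      ∃ C d : ℝ, 1 < d ∧ ∀ x : ℝ, ‖h x‖ ≤ C * (1 + |x|) ^ (-d) := by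
    rintro c f h hf ⟨C, d, hd, H⟩
    refine ⟨‖c‖ * C, d, hd, fun x => ?_⟩
    rw [hf, mul_assoc]
    exact mul_le_mul_of_nonneg_left (H x) (norm_nonneg c)
  induction ha using Submodule.span_induction with
  | mem a ha =>
    obtain ⟨s, a, ha, rfl⟩ := ha
    induction hb using Submodule.span_induction with
    | mem b hb =>
      obtain ⟨t, b, hb, rfl⟩ := hb
      obtain ⟨C, d, hd, H⟩ := S.decay (star a) (star_mem ha) b hb (s - t)
      refine ⟨C, d, hd, fun x => ?_⟩
      have h1 : S.conn2 (star (S.ι x (S.τ s a))) (S.τ t b) =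
          S.ω (S.ι x (S.τ (s - t) (star a)) * b) - S.ω (star a) * S.ω b := by
        have h2 : S.τ s a = S.τ t (S.τ (s - t) a) := by rw [← S.τ_add]; congr 2; ring
        rw [conn2_star_eq, h2, S.ι_τ_comm, ← map_star, ← map_mul, S.ω_τ, S.ω_τ, S.ω_τ, S.ω_τ,
          S.ω_star, map_star, map_star]
      rw [h1]
      exact H x
    | zero => exact ⟨0, 2, by norm_num, fun x => by simp [conn2]⟩
    | add b c _ _ hb hc =>
      refine key _ _ _ (fun x => ?_) hb hc
      refine le_of_eq_of_le (congrArg _ ?_) (norm_add_le _ _)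
      simp only [conn2, mul_add, map_add]; ring
    | smul c b _ hb =>
      refine key2 c _ _ (fun x => ?_) hb
      rw [← norm_mul]
      congr 1
      simp only [conn2, mul_smul_comm, map_smul, smul_eq_mul]; ring
  | zero => exact ⟨0, 2, by norm_num, fun x => by simp [conn2]⟩
  | add a c _ _ ha hc =>
    refine key _ _ _ (fun x => ?_) ha hc
    refine le_of_eq_of_le (congrArg _ ?_) (norm_add_le _ _)
    simp only [conn2, add_mul, map_add, star_add]; ring
  | smul c a _ ha =>
    refine key2 (star c) _ _ (fun x => ?_) ha
    rw [← norm_mul]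
    congr 1
    simp only [conn2, smul_mul_assoc, map_smul, smul_eq_mul, star_smul]; ring

lemma continuous_conn2 (a b : 𝔄) : Continuous fun x : ℝ => S.conn2 (star (S.ι x a)) b := by
  have h := S.continuous_corr 2 ![star a, b]
  have h2 : Continuous fun x : ℝ => (![(x, 0), (0, 0)] : Fin 2 → ℝ × ℝ) := by
    refine continuous_pi fun i => ?_
    fin_cases i
    · exact (continuous_id.prodMk continuous_const)
    · exact continuous_const
  have h3 := h.comp h2
  simp only [conn2_star_eq]
  refine Continuous.sub ?_ continuous_const
  refine h3.congr fun x => ?_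
  simp [ι_zero, τ_zero, List.ofFn_succ, map_star]

lemma integrable_conn2 {a b : 𝔄} (ha : a ∈ S.nucleus) (hb : b ∈ S.nucleus) :
    Integrable fun x : ℝ => S.conn2 (star (S.ι x a)) b := by
  obtain ⟨C, d, hd, H⟩ := S.exists_decay ha hb
  have h1 : Integrable fun x : ℝ => C * (1 + ‖x‖) ^ (-d) :=
    (integrable_one_add_norm (by simpa using hd)).const_mul C
  exact h1.mono' (S.continuous_conn2 a b).aestronglyMeasurable
    (Eventually.of_forall fun x => by simpa using H x)

/-- The semi-inner product `⟨a, b⟩ = ω (a† b)` on all observables. -/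
@[reducible] def stateCore : PreInnerProductSpace.Core ℂ 𝔄 where
  inner a b := S.ω (star a * b)
  conj_inner_symm a b := by
    rw [← Complex.star_def, ← S.ω_star]; simp
  re_inner_nonneg a := S.ω_nonneg a
  add_left a b c := by rw [star_add, add_mul, map_add]
  smul_left a b c := by simp

lemma conn2_shift (x y : ℝ) (a : 𝔄) :
    S.ω (star (S.ι x (a - S.ω a • 1)) * S.ι y (a - S.ω a • 1)) =
      S.conn2 (star (S.ι (x - y) a)) a := by
  have h : S.ι x (a - S.ω a • 1) = S.ι y (S.ι (x - y) (a - S.ω a • 1)) := by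
    rw [← S.ι_add]; congr 2; ring
  rw [h, ← map_star, ← map_mul, S.ω_ι, conn2_star_eq]
  simp [sub_mul, mul_sub, S.ω_star, S.ω_ι, S.ω_one]

lemma square_nonneg (a : 𝔄) (L : ℝ) :
    0 ≤ (∫ y in (0 : ℝ)..L, ∫ x in (0 : ℝ)..L, S.conn2 (star (S.ι (x - y) a)) a).re := by
  let _ : SeminormedAddCommGroup 𝔄 :=
    InnerProductSpace.Core.toSeminormedAddCommGroup (c := S.stateCore)
  let _ : InnerProductSpace ℂ 𝔄 := InnerProductSpace.ofCore S.stateCore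
  set b : 𝔄 := a - S.ω a • 1 with hb
  let F : ℝ → UniformSpace.Completion 𝔄 := fun x => ((S.ι x b : 𝔄) : UniformSpace.Completion 𝔄)
  have hin : ∀ x y, ⟪F x, F y⟫_ℂ = S.conn2 (star (S.ι (x - y) a)) a := by
    intro x y
    rw [UniformSpace.Completion.inner_coe, ← S.conn2_shift]
    rfl
  have hF : Continuous F := by
    rw [continuous_iff_continuousAt]
    intro y
    rw [ContinuousAt, tendsto_iff_norm_sub_tendsto_zero]
    have h1 : ∀ x, ‖F x - F y‖ ^ 2 =
        2 * (S.conn2 (star (S.ι 0 a)) a).re - 2 * (S.conn2 (star (S.ι (x - y) a)) a).re := by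
      intro x
      rw [@norm_sub_sq ℂ, ← hin x y, ← inner_self_eq_norm_sq (𝕜 := ℂ) (F x),
        ← inner_self_eq_norm_sq (𝕜 := ℂ) (F y), hin x x, hin y y, sub_self, sub_self]
      simp only [RCLike.re_to_complex]; ring
    have h2 : Tendsto (fun x => ‖F x - F y‖ ^ 2) (𝓝 y) (𝓝 0) := by
      simp only [h1]
      have h3 : Continuous fun x : ℝ => 2 * (S.conn2 (star (S.ι 0 a)) a).re
          - 2 * (S.conn2 (star (S.ι (x - y) a)) a).re := by
        have := (S.continuous_conn2 a a).comp (continuous_id.sub (continuous_const (y := y)))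
        exact continuous_const.sub (continuous_const.mul (Complex.continuous_re.comp this))
      have h4 := h3.tendsto y
      simpa using h4
    have h3 := h2.sqrt
    simpa using h3
  have hint : ∀ u v : ℝ, IntervalIntegrable F volume u v := fun u v => hF.intervalIntegrable u v
  have h1 : (∫ y in (0 : ℝ)..L, ∫ x in (0 : ℝ)..L, S.conn2 (star (S.ι (x - y) a)) a) =
      ⟪∫ x in (0 : ℝ)..L, F x, ∫ y in (0 : ℝ)..L, F y⟫_ℂ := by
    have h2 : ∀ c, ⟪c, ∫ y in (0 : ℝ)..L, F y⟫_ℂ = ∫ y in (0 : ℝ)..L, ⟪c, F y⟫_ℂ := by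
      intro c
      exact ((innerSL ℂ c).intervalIntegral_comp_comm (hint 0 L)).symm
    rw [h2]
    refine intervalIntegral.integral_congr fun y _ => ?_
    rw [← inner_conj_symm, h2]
    rw [← Complex.conjCLE_apply, ← ContinuousLinearEquiv.coe_coe,
      ← ContinuousLinearMap.intervalIntegral_comp_comm]
    · refine intervalIntegral.integral_congr fun x _ => ?_
      simp [← hin x y]
    · exact (continuous_const.inner hF).intervalIntegrable _ _
  rw [h1]
  exact inner_self_nonneg (𝕜 := ℂ)

lemma hydroForm_nonneg {a : 𝔄} (ha : a ∈ S.nucleus) : 0 ≤ (S.hydroForm a a).re := by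
  set f : ℝ → ℂ := fun x => S.conn2 (star (S.ι x a)) a with hf
  have hfi : Integrable f := S.integrable_conn2 ha ha
  have key : Tendsto (fun L : ℝ => ∫ r in (0 : ℝ)..1, ∫ w in (-(L * r))..(L - L * r), f w)
      atTop (𝓝 (∫ _r in (0 : ℝ)..1, ∫ w, f w)) := by
    refine intervalIntegral.tendsto_integral_filter_of_dominated_convergence
      (fun _ => ∫ w, ‖f w‖) ?_ ?_ ?_ ?_
    · refine Eventually.of_forall fun L => ?_
      have hc : Continuous fun r : ℝ => ∫ w in (-(L * r))..(L - L * r), f w := by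
        have hfc : Continuous f := S.continuous_conn2 a a
        have h1 : ∀ r : ℝ, (∫ w in (-(L * r))..(L - L * r), f w)
            = (∫ w in (0 : ℝ)..(L - L * r), f w) - ∫ w in (0 : ℝ)..(-(L * r)), f w := fun r =>
          (intervalIntegral.integral_interval_sub_left (hfc.intervalIntegrable _ _)
            (hfc.intervalIntegrable _ _)).symm
        simp only [h1]
        have h2 : Continuous fun b : ℝ => ∫ w in (0 : ℝ)..b, f w :=
          intervalIntegral.continuous_primitive (fun u v => hfc.intervalIntegrable u v) 0
        exact (h2.comp (by fun_prop)).sub (h2.comp (by fun_prop))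
      exact hc.aestronglyMeasurable
    · refine (eventually_ge_atTop 0).mono fun L hL => ae_of_all _ fun r _ => ?_
      rw [intervalIntegral.integral_of_le (by linarith)]
      refine (norm_integral_le_integral_norm _).trans ?_
      exact setIntegral_le_integral hfi.norm (ae_of_all _ fun _ => norm_nonneg _)
    · exact intervalIntegrable_const
    · have h1 : ∀ᵐ r : ℝ, r ≠ 1 := by simp [ae_iff]
      filter_upwards [h1] with r hr1 hr
      rw [uIoc_of_le zero_le_one] at hr
      have hlt : r < 1 := lt_of_le_of_ne hr.2 hr1
      refine intervalIntegral_tendsto_integral hfi ?_ ?_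
      · exact tendsto_neg_atTop_atBot.comp (tendsto_id.atTop_mul_const hr.1)
      · have : (fun L : ℝ => L - L * r) = fun L => L * (1 - r) := by ext L; ring
        rw [this]
        exact tendsto_id.atTop_mul_const (by linarith)
  simp only [intervalIntegral.integral_const, sub_zero, one_smul] at key
  have key2 := (Complex.continuous_re.tendsto _).comp key
  refine ge_of_tendsto key2 ((eventually_gt_atTop 0).mono fun L hL => ?_)
  have h1 := S.square_nonneg a L
  have h2 : (∫ y in (0 : ℝ)..L, ∫ x in (0 : ℝ)..L, f (x - y)) =
      L • ∫ r in (0 : ℝ)..1, ∫ w in (-(L * r))..(L - L * r), f w := by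
    have h3 := intervalIntegral.smul_integral_comp_mul_left (a := 0) (b := 1)
      (fun y : ℝ => ∫ x in (0 : ℝ)..L, f (x - y)) L
    rw [mul_zero, mul_one] at h3
    rw [← h3]
    congr 1
    refine intervalIntegral.integral_congr fun r _ => ?_
    rw [intervalIntegral.integral_comp_sub_right, zero_sub]
  have h4 : 0 ≤ (L • ∫ r in (0 : ℝ)..1, ∫ w in (-(L * r))..(L - L * r), f w).re := by
    rw [← h2]; exact h1
  rw [Complex.smul_re, smul_eq_mul] at h4
  exact nonneg_of_mul_nonneg_right h4 hL

lemma hydroForm_conj (a b : 𝔄) : star (S.hydroForm b a) = S.hydroForm a b := by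
  rw [hydroForm, hydroForm, Complex.star_def, ← integral_conj,
    ← integral_neg_eq_self (fun x => S.conn2 (star (S.ι x a)) b)]
  refine integral_congr_ae (ae_of_all _ fun x => ?_)
  simp only
  rw [← Complex.star_def, conn2_star_eq, conn2_star_eq, star_sub, star_mul', star_star,
    ← S.ω_star, star_mul, star_star, mul_comm (S.ω b)]
  congr 1
  rw [← S.ω_ι (-x) (star a * S.ι x b), map_mul, ← S.ι_add, neg_add_cancel, S.ι_zero, map_star]

lemma hydroForm_τ (t : ℝ) (a b : 𝔄) : S.hydroForm (S.τ t a) (S.τ t b) = S.hydroForm a b := by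
  unfold hydroForm
  refine integral_congr_ae (ae_of_all _ fun x => ?_)
  simp only
  rw [conn2_star_eq, conn2_star_eq, S.ι_τ_comm, ← map_star, ← map_mul, S.ω_τ, S.ω_τ, S.ω_τ]

/-- The nucleus, to be equipped with the semi-inner product `hydroForm`. -/
def Nucleus : Type _ := S.nucleus

instance : AddCommGroup S.Nucleus := inferInstanceAs (AddCommGroup S.nucleus)
instance : Module ℂ S.Nucleus := inferInstanceAs (Module ℂ S.nucleus)

/-- The underlying observable. -/
def Nucleus.val {S : ManyBodySystem 𝔄} (a : S.Nucleus) : 𝔄 := Subtype.val (p := (· ∈ S.nucleus)) a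

/-- An observable of the span, as an element of `Nucleus`. -/
def toNucleus (a : 𝔄) (ha : a ∈ S.nucleus) : S.Nucleus := (⟨a, ha⟩ : S.nucleus)

/-- The semi-inner product of the nucleus. -/
@[reducible] def hydroCore : PreInnerProductSpace.Core ℂ S.Nucleus where
  inner a b := S.hydroForm a.val b.val
  conj_inner_symm a b := S.hydroForm_conj a.val b.val
  re_inner_nonneg a := S.hydroForm_nonneg a.2
  add_left a b c := by
    have h : ∀ x, S.conn2 (star (S.ι x (a + b).val)) c.val =
        S.conn2 (star (S.ι x a.val)) c.val + S.conn2 (star (S.ι x b.val)) c.val := by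
      intro x
      have h0 : (a + b).val = a.val + b.val := rfl
      rw [h0]
      simp only [conn2, add_mul, map_add, star_add]; ring
    simp only [hydroForm, h]
    exact integral_add (S.integrable_conn2 a.2 c.2) (S.integrable_conn2 b.2 c.2)
  smul_left a b r := by
    have h : ∀ x, S.conn2 (star (S.ι x (r • a).val)) b.val =
        (starRingEnd ℂ) r * S.conn2 (star (S.ι x a.val)) b.val := by
      intro x
      have h0 : (r • a).val = r • a.val := rfl
      rw [h0]
      simp only [conn2, smul_mul_assoc, map_smul, smul_eq_mul, star_smul, Complex.star_def]; ring
    simp only [hydroForm, h]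
    exact integral_const_mul _ _

instance : SeminormedAddCommGroup S.Nucleus :=
  InnerProductSpace.Core.toSeminormedAddCommGroup (c := S.hydroCore)
instance : InnerProductSpace ℂ S.Nucleus := InnerProductSpace.ofCore S.hydroCore

/-- The first-order hydrodynamic Hilbert space: the Hilbert completion of the nucleus, modulo null
elements, for the inner product `∫ dx ⟨a(x)† b⟩ᶜ`. -/
abbrev HydroSpace : Type _ := UniformSpace.Completion S.Nucleus

/-- The class of a local observable in the hydrodynamic space. -/
def cls (a : 𝔄) (ha : a ∈ S.V) : S.HydroSpace :=
  ((S.toNucleus a (S.mem_nucleus ha) : S.Nucleus) : UniformSpace.Completion S.Nucleus)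

/-- Time translation on the nucleus. -/
def τNucleus (t : ℝ) : S.Nucleus →ₗᵢ[ℂ] S.Nucleus where
  toFun a := S.toNucleus (S.τ t a.val) (S.τ_mem_nucleus t a.2)
  map_add' a b := Subtype.ext (map_add (S.τ t) a.val b.val)
  map_smul' c a := Subtype.ext (map_smul (S.τ t) c a.val)
  norm_map' a := congrArg (fun z : ℂ => √z.re) (S.hydroForm_τ t a.val a.val)

/-- Time translation on the hydrodynamic space. -/
def τHydro (t : ℝ) : S.HydroSpace →L[ℂ] S.HydroSpace :=
  (S.τNucleus t).toContinuousLinearMap.completion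

/-- The ballistic space: the time-translation invariants of the hydrodynamic space. -/
def ballistic : Submodule ℂ S.HydroSpace := ⨅ t : ℝ, (S.τHydro t - 1).ker

lemma isClosed_ballistic : IsClosed (S.ballistic : Set S.HydroSpace) := by
  rw [ballistic, Submodule.coe_iInf]
  exact isClosed_iInter fun t => (S.τHydro t - 1).isClosed_ker

instance : CompleteSpace S.ballistic := S.isClosed_ballistic.completeSpace_coe

/-- `(1 - P_τ)`, where `P_τ` is the orthogonal projection onto the ballistic space. -/
def oneSubProj : S.HydroSpace →L[ℂ] S.HydroSpace := 1 - S.ballistic.starProjection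

/-- The lower norm of order `u`, `1 < u < 2`, of an element of the hydrodynamic space:
`[(3 - u) liminf_{T → ∞} (2T)^(u - 3) ‖∫_{-T}^T dt (1 - P_τ) τ_t ψ‖²]^(1/2)` in `[0, ∞]`. -/
def lowerNorm (u : ℝ) (ψ : S.HydroSpace) : ℝ≥0∞ :=
  (ENNReal.ofReal (3 - u) * liminf (fun T : ℝ => ENNReal.ofReal
    ((2 * T) ^ (u - 3) * ‖∫ t in (-T)..T, S.oneSubProj (S.τHydro t ψ)‖ ^ 2)) atTop) ^ (1 / 2 : ℝ)

/-- `ψ` has normal superdiffusion exponent `α`. -/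
def HasNormalExponent (ψ : S.HydroSpace) (α : ℝ) : Prop :=
  α ∈ Ioo (1 / 2 : ℝ) 1 ∧ ∀ u ∈ Ioo (1 : ℝ) 2,
    (u < 3 - 2 * α → S.lowerNorm u ψ = 0) ∧ (3 - 2 * α < u → S.lowerNorm u ψ = ⊤)

/-- `ψ` has fat superdiffusion exponent `α`. -/
def HasFatExponent (ψ : S.HydroSpace) (α : ℝ) : Prop :=
  α ∈ Ioo (1 / 2 : ℝ) 1 ∧ ∀ u ∈ Ioo (1 : ℝ) 2,
    (u < 1 / α → S.lowerNorm u ψ = 0) ∧ (1 / α < u → S.lowerNorm u ψ = ⊤)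

end HydroSpace

/-- A basis of normal modes of the ballistic space: local, self-adjoint conserved densities `q I`
with vanishing averages and local, self-adjoint currents `j I`, such that the densities form an
orthonormal basis of the ballistic space in which the flux Jacobian is diagonal, with the
velocities `vel I` on the diagonal. -/
structure NormalModes (S : ManyBodySystem 𝔄) (M : Type*) where
  q : M → 𝔄
  j : M → 𝔄
  vel : M → ℝ
  q_mem : ∀ I, q I ∈ S.V
  j_mem : ∀ I, j I ∈ S.V
  q_sa : ∀ I, IsSelfAdjoint (q I)
  j_sa : ∀ I, IsSelfAdjoint (j I)
  q_mean : ∀ I, S.ω (q I) = 0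
  /-- `∂ₜ q + ∂ₓ j = 0` inside correlation functions, integrated over a space-time rectangle -/
  conservation : ∀ (I : M) (A B : 𝔄) (x₁ x₂ t₁ t₂ : ℝ),
    (∫ x in x₁..x₂, S.ω (A * (S.shift x t₂ (q I) - S.shift x t₁ (q I)) * B)) +
      (∫ t in t₁..t₂, S.ω (A * (S.shift x₂ t (j I) - S.shift x₁ t (j I)) * B)) = 0
  orthonormal : Orthonormal ℂ fun I => S.cls (q I) (q_mem I)
  complete : (Submodule.span ℂ (range fun I => S.cls (q I) (q_mem I))).topologicalClosure =
    S.ballistic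
  diagonal : ∀ I K, I ≠ K → ⟪S.cls (q I) (q_mem I), S.cls (j K) (j_mem K)⟫_ℂ = 0
  velocity : ∀ I, ⟪S.cls (q I) (q_mem I), S.cls (j I) (j_mem I)⟫_ℂ = vel I

namespace NormalModes

variable {S : ManyBodySystem 𝔄} {M : Type*} (N : S.NormalModes M)

/-- The class of the current `j I` in the hydrodynamic space. -/
def current (I : M) : S.HydroSpace := S.cls (N.j I) (N.j_mem I)

/-- The local observable `(1 - P_τ) j_K`: since `P_τ j_K = ∑_L q_L ⟨q_L, j_K⟩ = vel_K q_K`, this is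
`j_K - vel_K q_K`. -/
def fluct (K : M) : 𝔄 := N.j K - (N.vel K : ℂ) • N.q K

lemma fluct_mem (K : M) : N.fluct K ∈ S.V :=
  sub_mem (N.j_mem K) (S.V.smul_mem (N.q_mem K) _)

/-- `fluct K` indeed represents `(1 - P_τ) j_K` in the hydrodynamic space. -/
lemma cls_fluct (K : M) : S.cls (N.fluct K) (N.fluct_mem K) = S.oneSubProj (N.current K) := by
  have hP : S.ballistic.starProjection (N.current K) =
      (N.vel K : ℂ) • S.cls (N.q K) (N.q_mem K) := by
    apply Submodule.eq_starProjection_of_mem_of_inner_eq_zero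
    · rw [← N.complete]
      exact Submodule.smul_mem _ _
        (Submodule.le_topologicalClosure _ (Submodule.subset_span ⟨K, rfl⟩))
    · intro w hw
      rw [← N.complete] at hw
      have h : (N.current K - (N.vel K : ℂ) • S.cls (N.q K) (N.q_mem K)) ∈
          (Submodule.span ℂ (range fun I => S.cls (N.q I) (N.q_mem I))).topologicalClosureᗮ := by
        rw [Submodule.orthogonal_closure, Submodule.mem_orthogonal]
        intro u hu
        induction hu using Submodule.span_induction with
        | mem x hx =>
          obtain ⟨L, rfl⟩ := hx
          simp only [inner_sub_right, inner_smul_right]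
          by_cases h : L = K
          · subst h
            have h1 := N.orthonormal.1 L
            rw [current, N.velocity, inner_self_eq_norm_sq_to_K, h1]; simp
          · rw [N.orthonormal.2 h, current, N.diagonal L K h]; simp
        | zero => simp
        | add x y _ _ hx hy => rw [inner_add_left, hx, hy, add_zero]
        | smul c x _ hx => rw [inner_smul_left, hx, mul_zero]
      rw [← inner_conj_symm, (Submodule.mem_orthogonal _ _).1 h w hw]; simp
  have h : S.oneSubProj (N.current K) =
      N.current K - (N.vel K : ℂ) • S.cls (N.q K) (N.q_mem K) := by
    simp [oneSubProj, hP]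
  rw [h]
  set b : S.Nucleus := S.toNucleus (N.j K) (S.mem_nucleus (N.j_mem K))
  set c : S.Nucleus := S.toNucleus (N.q K) (S.mem_nucleus (N.q_mem K))
  change ((b - (N.vel K : ℂ) • c : S.Nucleus) : UniformSpace.Completion S.Nucleus) =
    (b : UniformSpace.Completion S.Nucleus) - (N.vel K : ℂ) • (c : UniformSpace.Completion S.Nucleus)
  rw [UniformSpace.Completion.coe_sub, UniformSpace.Completion.coe_smul]

/-- The coupling `⟨Q_I² (1 - P_τ) j_K⟩ᶜ`. -/
def coupling (I K : M) : ℂ :=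
  ∫ y : ℝ × ℝ, S.conn3 (S.shift y.1 0 (N.q I)) (S.shift y.2 0 (N.q I)) (N.fluct K)

/-- Clustering of `⟨(1 - P_τ) j_K(x,t) q_I(y₁,0) q_I(y₂,0)⟩ᶜ` outside the region of width
`|κ t|^(u-1)` around the ballistic trajectory of mode `I`, for all `u > α + 1`.  The decay at
distance `w` from the trajectory is a finite sum of terms `O(|t|^(-ν) |w|^(ν - 1/α - 1))`; it is
only required within distances `v |t|`. -/
def SuperClustering (v : ℝ) (I K : M) (α : ℝ) : Prop :=
  ∀ u : ℝ, α + 1 < u → u < 2 → ∃ (κ C R : ℝ) (F : Finset ℝ),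
    0 < κ ∧ 0 < R ∧ (∀ ν ∈ F, -1 ≤ ν) ∧
      ∀ (x t : ℝ) (y : Fin 2 → ℝ), R ≤ |t| → (∀ i, |x - y i| ≤ v * |t|) →
        ∀ i, |κ * t| ^ (u - 1) ≤ |x - y i - N.vel I * t| →
          ‖S.conn3 (S.shift x t (N.fluct K)) (S.shift (y 0) 0 (N.q I)) (S.shift (y 1) 0 (N.q I))‖ ≤
            C * ∑ ν ∈ F, |t| ^ (-ν) * |x - y i - N.vel I * t| ^ (ν - 1 / α - 1)

end NormalModes

end ManyBodySystem

end

/-! The proof is a Cauchy-Schwarz lower bound in the hydrodynamic space. The time-integrated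
fluctuating current `J_T = ∫_{-T}^T (1 - P_τ) τ_t j_K dt` is tested against the bilinear charge `w_L
= ∫_{-L}^L q_I(0) q_I(y) dy`, which gives `‖J_T‖² ≥ |⟨w_L, J_T⟩|² / ‖w_L‖²`.

The denominator is at most of order `L` (`exists_norm_integral_pairCls_sq_le`): the covariance of
two bilinears is a fourth cumulant plus two pairings, and clustering makes each of these integrable
in all but one variable.

For the numerator, the overlap of `w_L` with the current at time `t` is the three-point function
integrated over the strip `|y₁ - y₂| ≤ L`. Over the whole plane the integral is the coupling `c =
⟨Q_I² (1 - P_τ) j_K⟩ᶜ` at every `t`, because the charges are conserved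
(`integral_conn3_eq_coupling`). What is lost off the strip is bounded in
`SuperClustering.exists_tail_bound`. If two densities are `2ℓ` apart, one of them is at least `ℓ`
away from the ballistic trajectory. Inside the cone the worst admissible decay is `|t| m^(-2 - 1/α)`
at distance `m`, whose planar integral over `m ≥ ℓ` is of order `T ℓ^(-1/α)` for `|t| ≤ T`. With `ℓ
= k T^(u-1)` this vanishes exactly when `u - 1 > α`. Outside the cone, clustering with `p > 3`
suffices.

Hence for `L = 2 k T^(u-1)` the overlap with `J_T` is eventually at least `|c| T`, and `‖J_T‖²` is
at least of order `T² / T^(u-1) = T^(3-u)`. So the lower norm of order `u` is nonzero for every `u ∈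
(α_I + 1, 2)` (`SuperClustering.lowerNorm_ne_zero`). An exponent of `j_K` makes it vanish below `3 -
2α_K`, respectively `1/α_K`, so this threshold is at most `α_I + 1`. For `K = I` the two
inequalities become `α ≥ 2/3` and `α (α + 1) ≥ 1`. -/

/-! ### Finite configurations of points on the line -/

/-- A configuration of `n` points on the line splits along a gap of width at least `1 / n` times
the distance of any two of its points. -/
lemma exists_gap {n : ℕ} (x : Fin n → ℝ) {i j : Fin n} (hij : i ≠ j) :
    ∃ A : Set (Fin n), A.Nonempty ∧ Aᶜ.Nonempty ∧
      ∀ k ∈ A, ∀ l ∈ Aᶜ, |x i - x j| / n ≤ |x k - x l| := by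
  set D := |x i - x j| / n with hD
  have hn : (0 : ℝ) < n := by exact_mod_cast i.pos
  have hD0 : 0 ≤ D := by positivity
  -- The group `A` is the component of `i` in the graph joining points closer than `D`. A path has
  -- at most `n - 1` edges, so it cannot bridge the distance `n * D` from `i` to `j`.
  let G : SimpleGraph (Fin n) := SimpleGraph.fromRel fun k l => |x k - x l| < D
  have hG : ∀ {k l}, G.Adj k l → |x k - x l| < D := by
    intro k l h
    rcases h.2 with h | h
    · exact h
    · rwa [abs_sub_comm]
  have hwalk : ∀ {k l} (w : G.Walk k l), |x k - x l| ≤ w.length * D := by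
    intro k l w
    induction w with
    | nil => simp
    | cons h w ih =>
      have := abs_sub_le (x _) (x _) (x _) |>.trans (add_le_add (hG h).le ih)
      rw [SimpleGraph.Walk.length_cons]
      push_cast
      linarith
  have hne : ¬ G.Reachable i j := by
    rintro h
    obtain ⟨w, hw⟩ := h.exists_isPath
    have h1 := hw.length_lt
    have h2 := hwalk w
    rw [Fintype.card_fin] at h1
    rcases hD0.eq_or_lt with h0 | h0
    -- For `D = 0` the graph has no edges, and the trivial walk would force `i = j`.
    · cases w with
      | nil => exact hij rfl
      | cons h w => exact absurd (hG h) (by rw [← h0]; exact not_lt.2 (abs_nonneg _))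
    · have h3 : |x i - x j| = n * D := by rw [hD]; field_simp
      have h4 : (w.length : ℝ) < n := by exact_mod_cast h1
      nlinarith
  refine ⟨{k | G.Reachable i k}, ⟨i, SimpleGraph.Reachable.refl _⟩, ⟨j, hne⟩, fun k hk l hl => ?_⟩
  by_contra! hlt
  have hkl : k ≠ l := by rintro rfl; exact hl hk
  exact hl (SimpleGraph.Reachable.trans hk
    (SimpleGraph.Adj.reachable (G := G) ⟨hkl, Or.inl hlt⟩))

lemma one_add_div_rpow_neg_le {n : ℝ} (hn : 1 ≤ n) {D p : ℝ} (hD : 0 ≤ D) (hp : 0 ≤ p) :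
    (1 + D / n) ^ (-p) ≤ n ^ p * (1 + D) ^ (-p) := by
  have hn0 : 0 < n := by linarith
  have h1 : (1 + D) / n ≤ 1 + D / n := by
    rw [add_div]
    gcongr
    rw [div_le_one hn0]; exact hn
  have h2 := Real.rpow_le_rpow_of_nonpos (z := -p) (by positivity) h1 (by linarith)
  rw [Real.div_rpow (by positivity) hn0.le, Real.rpow_neg hn0.le, div_inv_eq_mul] at h2
  linarith

namespace ManyBodySystem

variable {𝔄 : Type*} [Ring 𝔄] [StarRing 𝔄] [Algebra ℂ 𝔄] [StarModule ℂ 𝔄]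
variable (S : ManyBodySystem 𝔄)

/-! ### Translations -/

lemma shift_zero (a : 𝔄) : S.shift 0 0 a = a := by rw [shift, S.τ_zero, S.ι_zero]

lemma shift_shift (x t y s : ℝ) (a : 𝔄) :
    S.shift x t (S.shift y s a) = S.shift (x + y) (t + s) a := by
  rw [shift, shift, shift, ← S.ι_τ_comm, ← S.τ_add, ← S.ι_add]

lemma shift_mul (x t : ℝ) (a b : 𝔄) : S.shift x t (a * b) = S.shift x t a * S.shift x t b := by
  simp [shift]

lemma star_shift (x t : ℝ) (a : 𝔄) : star (S.shift x t a) = S.shift x t (star a) := by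
  simp [shift, map_star]

lemma ω_shift (x t : ℝ) (a : 𝔄) : S.ω (S.shift x t a) = S.ω a := by
  rw [shift, S.ω_ι, S.ω_τ]

lemma conn2_translate (x t : ℝ) (a b : 𝔄) :
    S.conn2 (S.shift x t a) (S.shift x t b) = S.conn2 a b := by
  simp only [conn2, ← shift_mul, ω_shift]

lemma conn3_translate (x t : ℝ) (a b c : 𝔄) :
    S.conn3 (S.shift x t a) (S.shift x t b) (S.shift x t c) = S.conn3 a b c := by
  simp only [conn3, ← shift_mul, ω_shift]

lemma star_conn3 (a b c : 𝔄) :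
    star (S.conn3 a b c) = S.conn3 (star c) (star b) (star a) := by
  simp only [conn3, star_add, star_sub, star_mul', ← S.ω_star, star_mul, mul_assoc]
  have h : star (2 : ℂ) = 2 := by simp
  rw [h]; ring

/-! ### Continuity of correlation functions -/

section Continuity

variable {X : Type*} [TopologicalSpace X]

lemma continuous_ω_two (a b : 𝔄) {x t y s : X → ℝ} (hx : Continuous x) (ht : Continuous t)
    (hy : Continuous y) (hs : Continuous s) :
    Continuous fun z => S.ω (S.shift (x z) (t z) a * S.shift (y z) (s z) b) := by
  have h := (S.continuous_corr 2 ![a, b]).comp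
    (f := fun z : X => ![(x z, t z), (y z, s z)]) (continuous_pi fun i => by
      fin_cases i
      · exact hx.prodMk ht
      · exact hy.prodMk hs)
  refine h.congr fun z => ?_
  simp [List.ofFn_succ, shift]

lemma continuous_ω_three (a b c : 𝔄) {x t y s w r : X → ℝ} (hx : Continuous x)
    (ht : Continuous t) (hy : Continuous y) (hs : Continuous s) (hw : Continuous w)
    (hr : Continuous r) :
    Continuous fun z => S.ω (S.shift (x z) (t z) a * S.shift (y z) (s z) b *
      S.shift (w z) (r z) c) := by
  have h := (S.continuous_corr 3 ![a, b, c]).comp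
    (f := fun z : X => ![(x z, t z), (y z, s z), (w z, r z)]) (continuous_pi fun i => by
      fin_cases i
      · exact hx.prodMk ht
      · exact hy.prodMk hs
      · exact hw.prodMk hr)
  refine h.congr fun z => ?_
  simp [List.ofFn_succ, shift, mul_assoc]

lemma continuous_ω_four (a b c d : 𝔄) {x t y s w r k l : X → ℝ} (hx : Continuous x)
    (ht : Continuous t) (hy : Continuous y) (hs : Continuous s) (hw : Continuous w)
    (hr : Continuous r) (hk : Continuous k) (hl : Continuous l) :
    Continuous fun z => S.ω (S.shift (x z) (t z) a * S.shift (y z) (s z) b *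
      S.shift (w z) (r z) c * S.shift (k z) (l z) d) := by
  have h := (S.continuous_corr 4 ![a, b, c, d]).comp
    (f := fun z : X => ![(x z, t z), (y z, s z), (w z, r z), (k z, l z)])
    (continuous_pi fun i => by
      fin_cases i
      · exact hx.prodMk ht
      · exact hy.prodMk hs
      · exact hw.prodMk hr
      · exact hk.prodMk hl)
  refine h.congr fun z => ?_
  simp [List.ofFn_succ, shift, mul_assoc]

lemma continuous_conn2_shift (a b : 𝔄) {x t y s : X → ℝ} (hx : Continuous x) (ht : Continuous t)
    (hy : Continuous y) (hs : Continuous s) :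
    Continuous fun z => S.conn2 (S.shift (x z) (t z) a) (S.shift (y z) (s z) b) := by
  simp only [conn2, ω_shift]
  exact (S.continuous_ω_two a b hx ht hy hs).sub continuous_const

lemma continuous_conn3_shift (a b c : 𝔄) {x t y s w r : X → ℝ} (hx : Continuous x)
    (ht : Continuous t) (hy : Continuous y) (hs : Continuous s) (hw : Continuous w)
    (hr : Continuous r) :
    Continuous fun z => S.conn3 (S.shift (x z) (t z) a) (S.shift (y z) (s z) b)
      (S.shift (w z) (r z) c) := by
  simp only [conn3, ω_shift]
  have h1 := S.continuous_ω_three a b c hx ht hy hs hw hr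
  have h2 := S.continuous_ω_two a b hx ht hy hs
  have h3 := S.continuous_ω_two a c hx ht hw hr
  have h4 := S.continuous_ω_two b c hy hs hw hr
  fun_prop

end Continuity

/-! ### Consequences of clustering -/

section Clustering

variable {S}

/-- Clustering in terms of the distance of any two of the points, provided that all time
differences are small compared to it. -/
lemma ClustersWith.exists_bound {v p : ℝ} {n : ℕ} {κ : (Fin n → 𝔄) → ℂ}
    (h : S.ClustersWith v p n κ) (hp : 0 ≤ p) (a : Fin n → 𝔄) (ha : ∀ i, a i ∈ S.V) :
    ∃ C : ℝ, 0 ≤ C ∧ ∀ (x t : Fin n → ℝ) (i j : Fin n), i ≠ j →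
      (∀ k l, n * (v * |t k - t l|) ≤ |x i - x j|) →
      ‖κ fun i => S.shift (x i) (t i) (a i)‖ ≤ C * (1 + |x i - x j|) ^ (-p) := by
  obtain ⟨C, hC⟩ := h a ha
  refine ⟨|C| * (n : ℝ) ^ p, by positivity, fun x t i j hij ht => ?_⟩
  obtain ⟨A, hA, hA', hgap⟩ := exists_gap x hij
  have hn : (1 : ℝ) ≤ n := by exact_mod_cast i.pos
  have h1 := hC x t A (|x i - x j| / n) hA hA' (by positivity) fun k hk l hl =>
    ⟨hgap k hk l hl, le_trans (by
      rw [le_div_iff₀ (by linarith)]; linarith [ht k l]) (hgap k hk l hl)⟩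
  have h2 := one_add_div_rpow_neg_le hn (abs_nonneg (x i - x j)) hp
  calc _ ≤ _ := h1
    _ ≤ |C| * (1 + |x i - x j| / n) ^ (-p) := by gcongr; exact le_abs_self C
    _ ≤ |C| * ((n : ℝ) ^ p * (1 + |x i - x j|) ^ (-p)) := by gcongr
    _ = _ := by ring

/-- Clustering uniformly for times in a bounded set. -/
lemma ClustersWith.exists_bound_of_abs_le {v p : ℝ} {n : ℕ} {κ : (Fin n → 𝔄) → ℂ}
    (h : S.ClustersWith v p n κ) (hv : 0 ≤ v) (hp : 0 ≤ p) (a : Fin n → 𝔄) (ha : ∀ i, a i ∈ S.V)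
    (hcont : Continuous fun z : Fin n → ℝ × ℝ => κ fun i => S.shift (z i).1 (z i).2 (a i))
    (hinv : ∀ (y : ℝ) (x t : Fin n → ℝ), (κ fun i => S.shift (y + x i) (t i) (a i)) =
      κ fun i => S.shift (x i) (t i) (a i)) (B : ℝ) :
    ∃ C : ℝ, 0 ≤ C ∧ ∀ (x t : Fin n → ℝ), (∀ k, |t k| ≤ B) → ∀ i j : Fin n,
      ‖κ fun i => S.shift (x i) (t i) (a i)‖ ≤ C * (1 + |x i - x j|) ^ (-p) := by
  obtain ⟨C₁, hC₁, H₁⟩ := h.exists_bound hp a ha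
  -- Beyond a separation `m` the cone condition holds automatically for times bounded by `B`.
  -- Configurations in which all separations are below `m` are translated into a compact set, where
  -- continuity gives a bound.
  set m : ℝ := n * (v * (2 * |B|)) with hm
  have hm0 : 0 ≤ m := by positivity
  have hK : IsCompact (univ.pi fun _ : Fin n => Icc (-m) m ×ˢ Icc (-B) B) :=
    isCompact_univ_pi fun _ => isCompact_Icc.prod isCompact_Icc
  obtain ⟨C₂, H₂⟩ := hK.exists_bound_of_continuousOn hcont.continuousOn
  set C := max C₁ |C₂| with hC
  have hC0 : 0 ≤ C := hC₁.trans (le_max_left _ _)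
  have hone : ∀ r : ℝ, (1 + |r|) ^ (-p) ≤ 1 := fun r =>
    Real.rpow_le_one_of_one_le_of_nonpos (by linarith [abs_nonneg r]) (by linarith)
  -- The factor `(1 + m) ^ p` makes the right-hand side at least `C` whenever `|x i - x j| ≤ m`.
  refine ⟨C * (1 + m) ^ p, by positivity, fun x t ht i j => ?_⟩
  have hfar : ∀ k l, k ≠ l → m ≤ |x k - x l| →
      ‖κ fun i => S.shift (x i) (t i) (a i)‖ ≤ C₁ * (1 + |x k - x l|) ^ (-p) := by
    refine fun k l hkl hm' => H₁ x t k l hkl fun k' l' => le_trans ?_ hm'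
    have : |t k' - t l'| ≤ 2 * |B| := by
      have h1 := abs_sub (t k') (t l')
      have := le_abs_self B
      linarith [ht k', ht l']
    rw [hm]; gcongr
  have hone' : 1 ≤ (1 + m) ^ p := Real.one_le_rpow (by linarith) hp
  by_cases hij : i ≠ j ∧ m ≤ |x i - x j|
  · refine (hfar i j hij.1 hij.2).trans ?_
    gcongr
    nlinarith [le_max_left C₁ |C₂|]
  · have hij' : |x i - x j| ≤ m := by
      by_cases hne : i = j
      · simpa [hne] using hm0
      · exact (not_le.1 fun h' => hij ⟨hne, h'⟩).le
    have hconst : ‖κ fun i => S.shift (x i) (t i) (a i)‖ ≤ C := by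
      by_cases hkl : ∃ k l, k ≠ l ∧ m ≤ |x k - x l|
      · obtain ⟨k, l, hne, hkl⟩ := hkl
        refine (hfar k l hne hkl).trans ((mul_le_of_le_one_right hC₁ (hone _)).trans
          (le_max_left _ _))
      · push Not at hkl
        rw [← hinv (-x i)]
        refine (H₂ (fun k => (-x i + x k, t k)) fun k _ => ⟨?_, ?_⟩).trans
          ((le_abs_self _).trans (le_max_right _ _))
        · rw [mem_Icc, ← abs_le]
          simp only [neg_add_eq_sub]
          by_cases hne : k = i
          · simpa [hne] using hm0
          · exact (hkl k i hne).le
        · rw [mem_Icc, ← abs_le]; exact ht k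
    have h3 : 1 ≤ (1 + m) ^ p * (1 + |x i - x j|) ^ (-p) := by
      rw [Real.rpow_neg (by positivity), ← div_eq_mul_inv, one_le_div (by positivity)]
      gcongr
    calc _ ≤ C * 1 := by rw [mul_one]; exact hconst
      _ ≤ C * ((1 + m) ^ p * (1 + |x i - x j|) ^ (-p)) := by gcongr
      _ = _ := by ring

variable {v p : ℝ}

lemma Clustering.exists_conn2_bound (h : S.Clustering v p) (hv : 0 ≤ v) (hp : 0 ≤ p)
    {a b : 𝔄} (ha : a ∈ S.V) (hb : b ∈ S.V) (B : ℝ) :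
    ∃ C : ℝ, 0 ≤ C ∧ ∀ x y t s : ℝ, |t| ≤ B → |s| ≤ B →
      ‖S.conn2 (S.shift x t a) (S.shift y s b)‖ ≤ C * (1 + |x - y|) ^ (-p) := by
  obtain ⟨C, hC, H⟩ := h.1.exists_bound_of_abs_le hv hp ![a, b]
    (by intro i; fin_cases i <;> assumption)
    (S.continuous_conn2_shift a b (by fun_prop) (by fun_prop) (by fun_prop) (by fun_prop))
    (fun y x t => by
      rw [← S.conn2_translate y 0 (S.shift (x 0) (t 0) _)]; simp only [shift_shift, zero_add]) B
  refine ⟨C, hC, fun x y t s ht hs => ?_⟩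
  exact H ![x, y] ![t, s] (by intro i; fin_cases i <;> assumption) 0 1

lemma Clustering.exists_conn3_bound (h : S.Clustering v p) (hv : 0 ≤ v) (hp : 0 ≤ p)
    {a b c : 𝔄} (ha : a ∈ S.V) (hb : b ∈ S.V) (hc : c ∈ S.V) (B : ℝ) :
    ∃ C : ℝ, 0 ≤ C ∧ ∀ x y w t s r : ℝ, |t| ≤ B → |s| ≤ B → |r| ≤ B →
      ‖S.conn3 (S.shift x t a) (S.shift y s b) (S.shift w r c)‖ ≤ C * (1 + |x - w|) ^ (-p) ∧
      ‖S.conn3 (S.shift x t a) (S.shift y s b) (S.shift w r c)‖ ≤ C * (1 + |y - w|) ^ (-p) := by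
  obtain ⟨C, hC, H⟩ := h.2.1.exists_bound_of_abs_le hv hp ![a, b, c]
    (by intro i; fin_cases i <;> assumption)
    (S.continuous_conn3_shift a b c (by fun_prop) (by fun_prop) (by fun_prop) (by fun_prop)
      (by fun_prop) (by fun_prop))
    (fun y x t => by
      rw [← S.conn3_translate y 0 (S.shift (x 0) (t 0) _)]; simp only [shift_shift, zero_add]) B
  refine ⟨C, hC, fun x y w t s r ht hs hr => ?_⟩
  have ht' : ∀ k, |(![t, s, r] : Fin 3 → ℝ) k| ≤ B := by intro i; fin_cases i <;> assumption
  exact ⟨H ![x, y, w] ![t, s, r] ht' 0 2, H ![x, y, w] ![t, s, r] ht' 1 2⟩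

/-- Equal-time clustering of the four-point function. -/
lemma Clustering.exists_conn4_bound (h : S.Clustering v p) (hp : 0 ≤ p)
    {a : 𝔄} (ha : a ∈ S.V) :
    ∃ C : ℝ, 0 ≤ C ∧ ∀ (x : Fin 4 → ℝ) (i j : Fin 4), i ≠ j →
      ‖S.conn4 (S.shift (x 0) 0 a) (S.shift (x 1) 0 a) (S.shift (x 2) 0 a) (S.shift (x 3) 0 a)‖ ≤
        C * (1 + |x i - x j|) ^ (-p) := by
  obtain ⟨C, hC, H⟩ := h.2.2.exists_bound hp (fun _ => a) (fun _ => ha)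
  exact ⟨C, hC, fun x i j hij => H x 0 i j hij (by simp)⟩

end Clustering

end ManyBodySystem

/-! ### Elementary estimates with powers -/

lemma one_add_abs_pos (x : ℝ) : 0 < 1 + |x| := by positivity

lemma integrable_one_add_abs {r : ℝ} (hr : 1 < r) : Integrable fun x : ℝ => (1 + |x|) ^ (-r) := by
  simpa using integrable_one_add_norm (E := ℝ) (μ := volume) (r := r) (by simpa using hr)

/-- Two power bounds combine to a product bound with half the power. -/
lemma le_mul_rpow_mul_rpow_of_le {e C A B p : ℝ} (hC : 0 ≤ C) (hA : 0 < A) (hB : 0 < B)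
    (hp : 0 ≤ p) (h₁ : e ≤ C * A ^ (-p)) (h₂ : e ≤ C * B ^ (-p)) :
    e ≤ C * (A ^ (-(p / 2)) * B ^ (-(p / 2))) := by
  have hsplit : ∀ {D : ℝ}, 0 < D → D ^ (-p) = D ^ (-(p / 2)) * D ^ (-(p / 2)) := by
    intro D hD
    rw [← Real.rpow_add hD]; congr 1; ring
  rcases le_total A B with h | h
  · refine h₂.trans ?_
    rw [hsplit hB]
    have := Real.rpow_le_rpow_of_nonpos (z := -(p / 2)) hA h (by linarith)
    gcongr
  · refine h₁.trans ?_
    rw [hsplit hA]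
    have := Real.rpow_le_rpow_of_nonpos (z := -(p / 2)) hB h (by linarith)
    gcongr

namespace ManyBodySystem

variable {𝔄 : Type*} [Ring 𝔄] [StarRing 𝔄] [Algebra ℂ 𝔄] [StarModule ℂ 𝔄]

/-! ### Correlation functions as linear functionals of one observable -/

section Insertions

variable (S : ManyBodySystem 𝔄)

/-- The functional `X ↦ ω (A X B)`. -/
def insertion (A B : 𝔄) : 𝔄 →ₗ[ℂ] ℂ := S.ω ∘ₗ LinearMap.mulRight ℂ B ∘ₗ LinearMap.mulLeft ℂ A

lemma insertion_apply (A B X : 𝔄) : S.insertion A B X = S.ω (A * X * B) := rfl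

/-- The span of the functionals `X ↦ ω (A X B)`. -/
def insertions : Submodule ℂ (𝔄 →ₗ[ℂ] ℂ) :=
  Submodule.span ℂ (range fun z : 𝔄 × 𝔄 => S.insertion z.1 z.2)

lemma insertion_mem (A B : 𝔄) : S.insertion A B ∈ S.insertions :=
  Submodule.subset_span ⟨(A, B), rfl⟩

lemma continuous_of_mem_insertions {κ : 𝔄 →ₗ[ℂ] ℂ} (hκ : κ ∈ S.insertions) (a : 𝔄) :
    Continuous fun z : ℝ × ℝ => κ (S.shift z.1 z.2 a) := by
  induction hκ using Submodule.span_induction with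
  | mem κ hκ =>
    obtain ⟨⟨A, B⟩, rfl⟩ := hκ
    have h := S.continuous_ω_three A a B (continuous_const (y := (0 : ℝ)))
      (continuous_const (y := (0 : ℝ))) (continuous_fst (X := ℝ) (Y := ℝ)) continuous_snd
      (continuous_const (y := (0 : ℝ))) (continuous_const (y := (0 : ℝ)))
    simpa only [shift_zero, insertion_apply] using h
  | zero => simpa using continuous_const
  | add κ κ' _ _ h h' => exact h.add h'
  | smul c κ _ h => exact h.const_smul c

/-- The three-point function as a functional of its first argument. -/
lemma exists_insertion_conn3_left (b c : 𝔄) :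
    ∃ κ ∈ S.insertions, ∀ X, κ X = S.conn3 X b c := by
  refine ⟨S.insertion 1 (b * c) - S.ω c • S.insertion 1 b - S.ω b • S.insertion 1 c
    - S.ω (b * c) • S.insertion 1 1 + (2 * (S.ω b * S.ω c)) • S.insertion 1 1, ?_, fun X => ?_⟩
  · have h := S.insertion_mem
    exact add_mem (sub_mem (sub_mem (sub_mem (h _ _) (Submodule.smul_mem _ _ (h _ _)))
      (Submodule.smul_mem _ _ (h _ _))) (Submodule.smul_mem _ _ (h _ _)))
      (Submodule.smul_mem _ _ (h _ _))
  · simp only [LinearMap.add_apply, LinearMap.sub_apply, LinearMap.smul_apply, insertion_apply,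
      one_mul, mul_one, smul_eq_mul, conn3, mul_assoc]
    ring

/-- The three-point function as a functional of its second argument. -/
lemma exists_insertion_conn3_middle (a c : 𝔄) :
    ∃ κ ∈ S.insertions, ∀ X, κ X = S.conn3 a X c := by
  refine ⟨S.insertion a c - S.ω c • S.insertion a 1 - S.ω (a * c) • S.insertion 1 1
    - S.ω a • S.insertion 1 c + (2 * (S.ω a * S.ω c)) • S.insertion 1 1, ?_, fun X => ?_⟩
  · have h := S.insertion_mem
    exact add_mem (sub_mem (sub_mem (sub_mem (h _ _) (Submodule.smul_mem _ _ (h _ _)))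
      (Submodule.smul_mem _ _ (h _ _))) (Submodule.smul_mem _ _ (h _ _)))
      (Submodule.smul_mem _ _ (h _ _))
  · simp only [LinearMap.add_apply, LinearMap.sub_apply, LinearMap.smul_apply, insertion_apply,
      one_mul, mul_one, smul_eq_mul, conn3, mul_assoc]
    ring

end Insertions

/-! ### Conservation laws and the conserved coupling -/

namespace NormalModes

variable {S : ManyBodySystem 𝔄} {M : Type*} (N : S.NormalModes M)

/-- Conservation is assumed only inside single products. Cumulants are linear combinations of these
in the inserted observable, so the law passes to them by linearity; continuity supplies the
integrability needed to split the integrals. -/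
lemma conservation_of_mem_insertions {κ : 𝔄 →ₗ[ℂ] ℂ} (hκ : κ ∈ S.insertions) (I : M)
    (x₁ x₂ t₁ t₂ : ℝ) :
    (∫ x in x₁..x₂, κ (S.shift x t₂ (N.q I) - S.shift x t₁ (N.q I))) +
      (∫ t in t₁..t₂, κ (S.shift x₂ t (N.j I) - S.shift x₁ t (N.j I))) = 0 := by
  have hint : ∀ {κ : 𝔄 →ₗ[ℂ] ℂ}, κ ∈ S.insertions →
      IntervalIntegrable (fun x => κ (S.shift x t₂ (N.q I) - S.shift x t₁ (N.q I)))
        volume x₁ x₂ ∧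
      IntervalIntegrable (fun t => κ (S.shift x₂ t (N.j I) - S.shift x₁ t (N.j I)))
        volume t₁ t₂ := by
    intro κ hκ
    have hq := S.continuous_of_mem_insertions hκ (N.q I)
    have hj := S.continuous_of_mem_insertions hκ (N.j I)
    simp only [map_sub]
    refine ⟨(Continuous.sub ?_ ?_).intervalIntegrable _ _,
      (Continuous.sub ?_ ?_).intervalIntegrable _ _⟩
    · exact hq.comp (f := fun x : ℝ => (x, t₂)) (by fun_prop)
    · exact hq.comp (f := fun x : ℝ => (x, t₁)) (by fun_prop)
    · exact hj.comp (f := fun t : ℝ => (x₂, t)) (by fun_prop)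
    · exact hj.comp (f := fun t : ℝ => (x₁, t)) (by fun_prop)
  induction hκ using Submodule.span_induction with
  | mem κ hκ =>
    obtain ⟨⟨A, B⟩, rfl⟩ := hκ
    exact N.conservation I A B x₁ x₂ t₁ t₂
  | zero => simp
  | add κ κ' hκ hκ' h h' =>
    simp only [LinearMap.add_apply]
    rw [intervalIntegral.integral_add (hint hκ).1 (hint hκ').1,
      intervalIntegral.integral_add (hint hκ).2 (hint hκ').2]
    linear_combination h + h'
  | smul c κ _ h =>
    simp only [LinearMap.smul_apply, intervalIntegral.integral_smul]
    rw [← smul_add, h, smul_zero]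

/-- A spatially integrated density is conserved inside any decaying functional. -/
lemma integral_shift_q_eq {κ : 𝔄 →ₗ[ℂ] ℂ} (hκ : κ ∈ S.insertions) (I : M) {p : ℝ} (hp : 1 < p)
    {C s : ℝ}
    (hq : ∀ x t, |t| ≤ |s| → ‖κ (S.shift x t (N.q I))‖ ≤ C * (1 + |x|) ^ (-p))
    (hj : ∀ x t, |t| ≤ |s| → ‖κ (S.shift x t (N.j I))‖ ≤ C * (1 + |x|) ^ (-p)) :
    ∫ x, κ (S.shift x s (N.q I)) = ∫ x, κ (S.shift x 0 (N.q I)) := by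
  have hint : ∀ t, |t| ≤ |s| → Integrable fun x => κ (S.shift x t (N.q I)) := fun t ht =>
    ((integrable_one_add_abs hp).const_mul C).mono'
      ((S.continuous_of_mem_insertions hκ (N.q I)).comp
        (f := fun x : ℝ => (x, t)) (by fun_prop)).aestronglyMeasurable
      (Eventually.of_forall fun x => hq x t ht)
  rw [← sub_eq_zero, ← integral_sub (hint s le_rfl) (hint 0 (by simp))]
  have h1 := intervalIntegral_tendsto_integral ((hint s le_rfl).sub (hint 0 (by simp)))
    tendsto_neg_atTop_atBot tendsto_id
  have h2 : Tendsto (fun X : ℝ => ∫ x in (-X)..X,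
      (κ (S.shift x s (N.q I)) - κ (S.shift x 0 (N.q I)))) atTop (𝓝 0) := by
    have hlim : Tendsto (fun X : ℝ => 2 * C * (1 + |X|) ^ (-p) * |s - 0|) atTop (𝓝 0) := by
      have h3 : Tendsto (fun X : ℝ => (1 + |X|) ^ (-p)) atTop (𝓝 0) :=
        (tendsto_rpow_neg_atTop (by linarith)).comp
          (tendsto_atTop_add_const_left _ _ tendsto_abs_atTop_atTop)
      simpa using (h3.const_mul (2 * C)).mul_const |s - 0|
    refine squeeze_zero_norm (fun X => ?_) hlim
    -- On `[-X, X]` the change of charge is the current through the endpoints during the elapsed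
    -- time, which decays as `X → ∞`.
    have h3 := N.conservation_of_mem_insertions hκ I (-X) X 0 s
    simp only [map_sub] at h3
    rw [eq_neg_of_add_eq_zero_left h3, norm_neg]
    refine intervalIntegral.norm_integral_le_of_norm_le_const fun t ht => ?_
    have ht' : |t| ≤ |s| := by
      rcases le_total 0 s with h | h
      · rw [uIoc_of_le h] at ht
        exact abs_le_abs_of_nonneg ht.1.le ht.2
      · rw [uIoc_of_ge h] at ht
        rw [abs_of_nonpos ht.2, abs_of_nonpos h]; linarith [ht.1]
    refine (norm_sub_le _ _).trans ?_
    have h4 := hj X t ht'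
    have h5 := hj (-X) t ht'
    rw [abs_neg] at h5
    linarith
  exact tendsto_nhds_unique h1 h2

variable {v p : ℝ}

/-- At fixed times, three-point functions are bounded by an integrable product of powers. -/
lemma exists_conn3_prod_bound (hcl : S.Clustering v p) (hv : 0 ≤ v) (hp : 0 ≤ p)
    {a b c : 𝔄} (ha : a ∈ S.V) (hb : b ∈ S.V) (hc : c ∈ S.V) (B : ℝ) :
    ∃ C : ℝ, 0 ≤ C ∧ ∀ x y t s r : ℝ, |t| ≤ B → |s| ≤ B → |r| ≤ B →
      ‖S.conn3 (S.shift x t a) (S.shift y s b) (S.shift 0 r c)‖ ≤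
        C * ((1 + |x|) ^ (-(p / 2)) * (1 + |y|) ^ (-(p / 2))) := by
  obtain ⟨C, hC, H⟩ := hcl.exists_conn3_bound hv hp ha hb hc B
  refine ⟨C, hC, fun x y t s r ht hs hr => ?_⟩
  have h := H x y 0 t s r ht hs hr
  simp only [sub_zero] at h
  exact le_mul_rpow_mul_rpow_of_le hC (one_add_abs_pos x) (one_add_abs_pos y) hp h.1 h.2

lemma integrable_conn3_shift (hcl : S.Clustering v p) (hv : 0 ≤ v) (hp : 2 < p)
    {a b c : 𝔄} (ha : a ∈ S.V) (hb : b ∈ S.V) (hc : c ∈ S.V) (t s r : ℝ) :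
    Integrable fun y : ℝ × ℝ => S.conn3 (S.shift y.1 t a) (S.shift y.2 s b) (S.shift 0 r c) := by
  obtain ⟨C, hC, H⟩ := exists_conn3_prod_bound hcl hv (by linarith) ha hb hc (max |t| (max |s| |r|))
  have hi := integrable_one_add_abs (r := p / 2) (by linarith)
  refine ((hi.mul_prod hi).const_mul C).mono' (S.continuous_conn3_shift a b c (by fun_prop)
    (by fun_prop) (by fun_prop) (by fun_prop) (by fun_prop) (by fun_prop)).aestronglyMeasurable
    (Eventually.of_forall fun y => H _ _ _ _ _ ?_ ?_ ?_) <;> simp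

/-- The coupling is conserved: it may be evaluated with the observable at any time. -/
lemma integral_conn3_eq_coupling (hcl : S.Clustering v p) (hv : 0 ≤ v) (hp : 2 < p) (I K : M)
    (t : ℝ) :
    ∫ y : ℝ × ℝ, S.conn3 (S.shift y.1 0 (N.q I)) (S.shift y.2 0 (N.q I))
      (S.shift 0 t (N.fluct K)) = N.coupling I K := by
  have hq := N.q_mem I
  have hj := N.j_mem I
  have hf := N.fluct_mem K
  have hp0 : 0 ≤ p := by linarith
  have hint := fun t s => integrable_conn3_shift hcl hv hp hq hq hf t s 0
  -- A time translation puts the current at time `0` and both densities at `-t`. The densities are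
  -- then returned to time `0` one after the other, each by conservation of its spatial integral.
  have h1 : ∀ y : ℝ × ℝ, S.conn3 (S.shift y.1 0 (N.q I)) (S.shift y.2 0 (N.q I))
      (S.shift 0 t (N.fluct K)) = S.conn3 (S.shift y.1 (-t) (N.q I)) (S.shift y.2 (-t) (N.q I))
      (S.shift 0 0 (N.fluct K)) := by
    intro y
    rw [← S.conn3_translate 0 (-t)]
    simp only [shift_shift, zero_add, add_zero, neg_add_cancel]
  have h2 : ∫ y : ℝ × ℝ, S.conn3 (S.shift y.1 (-t) (N.q I)) (S.shift y.2 (-t) (N.q I))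
      (S.shift 0 0 (N.fluct K)) = ∫ y : ℝ × ℝ, S.conn3 (S.shift y.1 0 (N.q I))
      (S.shift y.2 (-t) (N.q I)) (S.shift 0 0 (N.fluct K)) := by
    rw [Measure.volume_eq_prod, integral_prod_symm _ (hint (-t) (-t)),
      integral_prod_symm _ (hint 0 (-t))]
    congr 1
    ext y
    obtain ⟨κ, hκ, hκ'⟩ := S.exists_insertion_conn3_left (S.shift y (-t) (N.q I))
      (S.shift 0 0 (N.fluct K))
    obtain ⟨C₁, hC₁, H₁⟩ := hcl.exists_conn3_bound hv hp0 hq hq hf |-t|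
    obtain ⟨C₂, hC₂, H₂⟩ := hcl.exists_conn3_bound hv hp0 hj hq hf |-t|
    simp only [← hκ']
    refine N.integral_shift_q_eq hκ I (by linarith : 1 < p) (C := max C₁ C₂)
      (fun x s hs => ?_) (fun x s hs => ?_) <;> rw [hκ']
    · refine (H₁ x y 0 s (-t) 0 hs le_rfl (by simp)).1.trans ?_
      rw [sub_zero]
      gcongr
      exact le_max_left _ _
    · refine (H₂ x y 0 s (-t) 0 hs le_rfl (by simp)).1.trans ?_
      rw [sub_zero]
      gcongr
      exact le_max_right _ _
  have h3 : ∫ y : ℝ × ℝ, S.conn3 (S.shift y.1 0 (N.q I)) (S.shift y.2 (-t) (N.q I))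
      (S.shift 0 0 (N.fluct K)) = ∫ y : ℝ × ℝ, S.conn3 (S.shift y.1 0 (N.q I))
      (S.shift y.2 0 (N.q I)) (S.shift 0 0 (N.fluct K)) := by
    rw [Measure.volume_eq_prod, integral_prod _ (hint 0 (-t)), integral_prod _ (hint 0 0)]
    congr 1
    ext y
    obtain ⟨κ, hκ, hκ'⟩ := S.exists_insertion_conn3_middle (S.shift y 0 (N.q I))
      (S.shift 0 0 (N.fluct K))
    obtain ⟨C₁, hC₁, H₁⟩ := hcl.exists_conn3_bound hv hp0 hq hq hf |-t|
    obtain ⟨C₂, hC₂, H₂⟩ := hcl.exists_conn3_bound hv hp0 hq hj hf |-t|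
    simp only [← hκ']
    refine N.integral_shift_q_eq hκ I (by linarith : 1 < p) (C := max C₁ C₂)
      (fun x s hs => ?_) (fun x s hs => ?_) <;> rw [hκ']
    · refine (H₁ y x 0 0 s 0 (by simp) hs (by simp)).2.trans ?_
      rw [sub_zero]
      gcongr
      exact le_max_left _ _
    · refine (H₂ y x 0 0 s 0 (by simp) hs (by simp)).2.trans ?_
      rw [sub_zero]
      gcongr
      exact le_max_right _ _
  simp only [h1]
  rw [h2, h3, coupling]
  simp only [shift_zero]

end NormalModes

end ManyBodySystem

/-! ### Auxiliary facts on Hilbert spaces and integrals -/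

/-- Expanding `‖F x - F y‖²` leaves only inner products. Strong continuity of vectors thereby
reduces to continuity of correlation integrals. -/
lemma continuous_of_continuous_inner {X E : Type*} [TopologicalSpace X] [NormedAddCommGroup E]
    [InnerProductSpace ℂ E] {F : X → E} (h : Continuous fun z : X × X => ⟪F z.1, F z.2⟫_ℂ) :
    Continuous F := by
  rw [continuous_iff_continuousAt]
  intro y
  rw [ContinuousAt, tendsto_iff_norm_sub_tendsto_zero]
  have h1 : ∀ x, ‖F x - F y‖ ^ 2 =
      (⟪F x, F x⟫_ℂ).re - 2 * (⟪F x, F y⟫_ℂ).re + (⟪F y, F y⟫_ℂ).re := by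
    intro x
    rw [@norm_sub_sq ℂ, ← inner_self_eq_norm_sq (𝕜 := ℂ) (F x),
      ← inner_self_eq_norm_sq (𝕜 := ℂ) (F y)]
    simp only [RCLike.re_to_complex]
  have h2 : Continuous fun x => ‖F x - F y‖ ^ 2 := by
    simp only [h1]
    have ha := Complex.continuous_re.comp (h.comp (continuous_id.prodMk continuous_id))
    have hb := Complex.continuous_re.comp
      (h.comp (continuous_id.prodMk (continuous_const (y := y))))
    exact (ha.sub (hb.const_mul 2)).add continuous_const
  have h3 := (h2.tendsto y).sqrt
  simpa using h3

lemma inner_intervalIntegral_right {E : Type*} [NormedAddCommGroup E] [InnerProductSpace ℂ E]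
    [CompleteSpace E] {F : ℝ → E} (hF : Continuous F) (c : E) (a b : ℝ) :
    ⟪c, ∫ y in a..b, F y⟫_ℂ = ∫ y in a..b, ⟪c, F y⟫_ℂ :=
  ((innerSL ℂ c).intervalIntegral_comp_comm (hF.intervalIntegrable a b)).symm

lemma inner_intervalIntegral_left {E : Type*} [NormedAddCommGroup E] [InnerProductSpace ℂ E]
    [CompleteSpace E] {F : ℝ → E} (hF : Continuous F) (c : E) (a b : ℝ) :
    ⟪∫ y in a..b, F y, c⟫_ℂ = ∫ y in a..b, ⟪F y, c⟫_ℂ := by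
  rw [← inner_conj_symm, inner_intervalIntegral_right hF, ← Complex.conjCLE_apply,
    ← ContinuousLinearEquiv.coe_coe, ← ContinuousLinearMap.intervalIntegral_comp_comm]
  · simp
  · exact (continuous_const.inner hF).intervalIntegrable _ _

/-- The shear turns a separation and a base point into the positions of two densities; a strip
around the diagonal becomes a product set. -/
lemma measurePreserving_shear : MeasurePreserving (fun z : ℝ × ℝ => (z.2 + z.1, z.2))
    (volume.prod volume) (volume.prod volume) :=
  Measure.measurePreserving_swap.comp (measurePreserving_prod_add_swap volume volume)

lemma measurableEmbedding_shear : MeasurableEmbedding fun z : ℝ × ℝ => (z.2 + z.1, z.2) := by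
  let e : ℝ × ℝ ≃ₜ ℝ × ℝ :=
    { toFun := fun z => (z.2 + z.1, z.2)
      invFun := fun z => (z.1 - z.2, z.2)
      left_inv := fun z => by simp
      right_inv := fun z => by simp }
  exact e.measurableEmbedding

/-- Restricting a planar integral to a strip around the diagonal costs at most the integral of the
norm off the strip. -/
lemma norm_integral_strip_sub_le {Φ : ℝ × ℝ → ℂ} (hΦ : Integrable Φ) {L : ℝ} (hL : 0 ≤ L) :
    ‖(∫ y in (-L)..L, ∫ x, Φ (x + y, x)) - ∫ z, Φ z‖ ≤
      ∫ z in {z : ℝ × ℝ | L ≤ |z.1 - z.2|}, ‖Φ z‖ := by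
  have he := measurePreserving_shear
  have heE := measurableEmbedding_shear
  rw [Measure.volume_eq_prod] at hΦ ⊢
  have hΨ : Integrable (fun z : ℝ × ℝ => Φ (z.2 + z.1, z.2)) (volume.prod volume) :=
    (he.integrable_comp_emb heE).2 hΦ
  have h1 : (∫ y in (-L)..L, ∫ x, Φ (x + y, x)) =
      ∫ z in Ioc (-L) L ×ˢ univ, Φ (z.2 + z.1, z.2) ∂(volume.prod volume) := by
    rw [intervalIntegral.integral_of_le (by linarith), setIntegral_prod _ hΨ.integrableOn]
    simp
  have hm : MeasurableSet (Ioc (-L) L ×ˢ (univ : Set ℝ)) :=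
    measurableSet_Ioc.prod MeasurableSet.univ
  have hs : MeasurableSet {z : ℝ × ℝ | L ≤ |z.1 - z.2|} :=
    measurableSet_le measurable_const (by fun_prop)
  rw [h1, ← he.integral_comp heE Φ, ← integral_add_compl hm hΨ, sub_add_cancel_left, norm_neg]
  refine (norm_integral_le_integral_norm _).trans ?_
  rw [← he.setIntegral_preimage_emb heE fun z => ‖Φ z‖]
  refine setIntegral_mono_set hΨ.norm.integrableOn (ae_of_all _ fun z => norm_nonneg _)
    (LE.le.eventuallyLE fun z hz => ?_)
  simp only [mem_compl_iff, mem_prod, mem_Ioc, mem_univ, and_true, not_and_or, not_lt,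
    not_le] at hz
  simp only [mem_preimage, mem_ofPred_eq, add_sub_cancel_left, le_abs]
  rcases hz with hz | hz
  · right; linarith
  · left; exact hz.le

/-- Two power bounds in points `x` and `x'` give decay in `x` and in `x - x'`. -/
lemma le_mul_rpow_mul_rpow_sub {e C p x x' : ℝ} (hC : 0 ≤ C) (hp : 0 ≤ p)
    (h₁ : e ≤ C * (1 + |x|) ^ (-p)) (h₂ : e ≤ C * (1 + |x'|) ^ (-p)) :
    e ≤ C * 2 ^ p * ((1 + |x|) ^ (-(p / 2)) * (1 + |x - x'|) ^ (-(p / 2))) := by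
  have hone : (1 : ℝ) ≤ 2 ^ p := Real.one_le_rpow (by norm_num) hp
  -- Decay in `x - x'` comes from the larger of `|x|` and `|x'|`, which is at least `|x - x'| / 2`.
  have key : ∀ y : ℝ, 1 + |x - x'| ≤ 2 * (1 + |y|) → e ≤ C * (1 + |y|) ^ (-p) →
      e ≤ C * 2 ^ p * (1 + |x - x'|) ^ (-p) := by
    intro y hy he
    have h3 := Real.rpow_le_rpow_of_nonpos (z := -p) (by positivity) hy (by linarith)
    rw [Real.mul_rpow (by norm_num) (by positivity)] at h3
    have h4 : (2 : ℝ) ^ p * 2 ^ (-p) = 1 := by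
      rw [← Real.rpow_add (by norm_num), add_neg_cancel, Real.rpow_zero]
    calc e ≤ C * (2 ^ p * 2 ^ (-p)) * (1 + |y|) ^ (-p) := by rw [h4, mul_one]; exact he
      _ = C * 2 ^ p * (2 ^ (-p) * (1 + |y|) ^ (-p)) := by ring
      _ ≤ _ := by gcongr
  refine le_mul_rpow_mul_rpow_of_le (by positivity) (one_add_abs_pos _) (one_add_abs_pos _) hp
    (h₁.trans ?_) ?_
  · gcongr
    nlinarith
  · have h3 := abs_sub x x'
    rcases le_total |x| |x'| with h | h
    · exact key x' (by linarith) h₂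
    · exact key x (by linarith) h₁

namespace ManyBodySystem

variable {𝔄 : Type*} [Ring 𝔄] [StarRing 𝔄] [Algebra ℂ 𝔄] [StarModule ℂ 𝔄]

/-! ### The hydrodynamic space -/

section HydroSpace

variable (S : ManyBodySystem 𝔄)

lemma inner_cls_τHydro {a b : 𝔄} (ha : a ∈ S.V) (hb : b ∈ S.V) (t : ℝ) :
    ⟪S.cls a ha, S.τHydro t (S.cls b hb)⟫_ℂ = S.hydroForm a (S.τ t b) := by
  rw [τHydro, cls, cls, ContinuousLinearMap.completion_apply_coe, UniformSpace.Completion.inner_coe]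
  rfl

lemma inner_cls {a b : 𝔄} (ha : a ∈ S.V) (hb : b ∈ S.V) :
    ⟪S.cls a ha, S.cls b hb⟫_ℂ = S.hydroForm a b := by
  rw [cls, cls, UniformSpace.Completion.inner_coe]
  rfl

lemma inner_τHydro_cls {a b : 𝔄} (ha : a ∈ S.V) (hb : b ∈ S.V) (s t : ℝ) :
    ⟪S.τHydro s (S.cls a ha), S.τHydro t (S.cls b hb)⟫_ℂ = S.hydroForm (S.τ s a) (S.τ t b) := by
  rw [τHydro, τHydro, cls, cls, ContinuousLinearMap.completion_apply_coe,
    ContinuousLinearMap.completion_apply_coe, UniformSpace.Completion.inner_coe]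
  rfl

lemma inner_τHydro_τHydro (t : ℝ) (ψ φ : S.HydroSpace) :
    ⟪S.τHydro t ψ, S.τHydro t φ⟫_ℂ = ⟪ψ, φ⟫_ℂ := by
  induction ψ, φ using UniformSpace.Completion.induction_on₂ with
  | hp => exact isClosed_eq (by fun_prop) (by fun_prop)
  | ih a b =>
    rw [τHydro, ContinuousLinearMap.completion_apply_coe,
      ContinuousLinearMap.completion_apply_coe, UniformSpace.Completion.inner_coe,
      UniformSpace.Completion.inner_coe]
    exact (S.τNucleus t).inner_map_map a b

lemma τHydro_of_mem_ballistic {ψ : S.HydroSpace} (hψ : ψ ∈ S.ballistic) (t : ℝ) :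
    S.τHydro t ψ = ψ := by
  have h := (Submodule.mem_iInf _).1 hψ t
  simpa [sub_eq_zero] using h

/-- The projection on the ballistic space is invariant under time translations. -/
lemma starProjection_τHydro (t : ℝ) (ψ : S.HydroSpace) :
    S.ballistic.starProjection (S.τHydro t ψ) = S.ballistic.starProjection ψ := by
  apply Submodule.eq_starProjection_of_mem_of_inner_eq_zero
  · exact Submodule.starProjection_apply_mem _ _
  · intro w hw
    have h := Submodule.starProjection_inner_eq_zero (K := S.ballistic) ψ w hw
    rw [inner_sub_left] at h ⊢
    rw [← h]
    congr 1
    -- A ballistic `w` equals its own time translate, so the isometry property removes the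
    -- translation from both sides of the inner product.
    conv_lhs => rw [← S.τHydro_of_mem_ballistic hw t]
    exact S.inner_τHydro_τHydro t _ _

variable {S} {v p : ℝ}

lemma continuous_τHydro_cls (hcl : S.Clustering v p) (hv : 0 ≤ v) (hp : 1 < p) {a : 𝔄}
    (ha : a ∈ S.V) : Continuous fun t => S.τHydro t (S.cls a ha) := by
  refine continuous_of_continuous_inner ?_
  simp only [inner_τHydro_cls, hydroForm]
  have hsh : ∀ x s t, S.conn2 (star (S.ι x (S.τ s a))) (S.τ t a) =
      S.conn2 (S.shift x s (star a)) (S.shift 0 t a) := by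
    intro x s t
    rw [← star_shift]; simp [shift, ι_zero]
  simp only [hsh]
  rw [continuous_iff_continuousAt]
  intro z
  set B := ‖z‖ + 1 with hB
  obtain ⟨C, hC, H⟩ := hcl.exists_conn2_bound hv (by linarith) (star_mem ha) ha B
  refine continuousAt_of_dominated (bound := fun x => C * (1 + |x|) ^ (-p)) ?_ ?_
    ((integrable_one_add_abs hp).const_mul C) ?_
  · exact Eventually.of_forall fun w => (S.continuous_conn2_shift _ _ (by fun_prop) (by fun_prop)
      (by fun_prop) (by fun_prop)).aestronglyMeasurable
  · filter_upwards [Metric.ball_mem_nhds z one_pos] with w hw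
    refine ae_of_all _ fun x => ?_
    have hw' : ‖w‖ ≤ B := by
      have := norm_sub_norm_le w z
      rw [mem_ball_iff_norm] at hw
      linarith
    have := H x 0 w.1 w.2 ((norm_fst_le w).trans hw') ((norm_snd_le w).trans hw')
    rwa [sub_zero] at this
  · exact ae_of_all _ fun x => (S.continuous_conn2_shift _ _ (by fun_prop) (by fun_prop)
      (by fun_prop) (by fun_prop)).continuousAt

end HydroSpace

namespace NormalModes

variable {S : ManyBodySystem 𝔄} {M : Type*} (N : S.NormalModes M)

/-- This trades the abstract projected current for the class of a local observable, whose overlaps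
are integrals of correlation functions. -/
lemma oneSubProj_τHydro_current (K : M) (t : ℝ) :
    S.oneSubProj (S.τHydro t (N.current K)) = S.τHydro t (S.cls (N.fluct K) (N.fluct_mem K)) := by
  have h : S.cls (N.fluct K) (N.fluct_mem K) =
      N.current K - S.ballistic.starProjection (N.current K) := by
    rw [N.cls_fluct]; simp [oneSubProj]
  rw [h, map_sub, S.τHydro_of_mem_ballistic (Submodule.starProjection_apply_mem _ _)]
  simp [oneSubProj, starProjection_τHydro]

lemma fluct_sa (K : M) : IsSelfAdjoint (N.fluct K) := by
  refine (N.j_sa K).sub ?_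
  rw [IsSelfAdjoint, star_smul, (N.q_sa K).star_eq]
  simp

/-! ### Bilinear observables -/

lemma pair_mem (I : M) (y : ℝ) : N.q I * S.ι y (N.q I) ∈ S.V :=
  mul_mem (N.q_mem I) (S.ι_mem y _ (N.q_mem I))

/-- The class of the bilinear observable `q_I(0) q_I(y)`. -/
noncomputable def pairCls (I : M) (y : ℝ) : S.HydroSpace :=
  S.cls (N.q I * S.ι y (N.q I)) (N.pair_mem I y)

lemma star_ι_pair (I : M) (x y : ℝ) :
    star (S.ι x (N.q I * S.ι y (N.q I))) = S.shift (x + y) 0 (N.q I) * S.shift x 0 (N.q I) := by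
  rw [map_mul, star_mul, ← S.ι_add, ← map_star, ← map_star, (N.q_sa I).star_eq]
  simp [shift, τ_zero]

/-- Because the densities have mean zero, the covariance of their product with a third observable is
already the third cumulant. -/
lemma inner_pairCls_τHydro (I K : M) (y t : ℝ) :
    ⟪N.pairCls I y, S.τHydro t (S.cls (N.fluct K) (N.fluct_mem K))⟫_ℂ =
      ∫ x, S.conn3 (S.shift (x + y) 0 (N.q I)) (S.shift x 0 (N.q I))
        (S.shift 0 t (N.fluct K)) := by
  rw [pairCls, inner_cls_τHydro, hydroForm]
  congr 1
  ext x
  rw [star_ι_pair, conn2, conn3]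
  simp only [ω_shift, N.q_mean]
  simp [shift, ι_zero, S.ω_τ]

/-- The overlap density of two bilinear observables. -/
noncomputable def pairCorr (I : M) (y y' x : ℝ) : ℂ :=
  S.ω (S.shift (x + y) 0 (N.q I) * S.shift x 0 (N.q I) * S.shift 0 0 (N.q I) *
      S.shift y' 0 (N.q I)) -
    S.ω (S.shift (x + y) 0 (N.q I) * S.shift x 0 (N.q I)) *
      S.ω (S.shift 0 0 (N.q I) * S.shift y' 0 (N.q I))

lemma inner_pairCls (I : M) (y y' : ℝ) :
    ⟪N.pairCls I y, N.pairCls I y'⟫_ℂ = ∫ x, N.pairCorr I y y' x := by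
  rw [pairCls, pairCls, inner_cls, hydroForm]
  congr 1
  ext x
  rw [star_ι_pair, conn2, pairCorr, shift_zero]
  simp [shift, τ_zero, mul_assoc]

/-- With mean-zero factors the four-point average is the fourth cumulant plus three pairings; the
covariance removes the pairing internal to each bilinear. -/
lemma pairCorr_eq (I : M) (y y' x : ℝ) : N.pairCorr I y y' x =
    S.conn4 (S.shift (x + y) 0 (N.q I)) (S.shift x 0 (N.q I)) (S.shift 0 0 (N.q I))
      (S.shift y' 0 (N.q I)) +
    S.conn2 (S.shift (x + y) 0 (N.q I)) (S.shift 0 0 (N.q I)) *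
      S.conn2 (S.shift x 0 (N.q I)) (S.shift y' 0 (N.q I)) +
    S.conn2 (S.shift (x + y) 0 (N.q I)) (S.shift y' 0 (N.q I)) *
      S.conn2 (S.shift x 0 (N.q I)) (S.shift 0 0 (N.q I)) := by
  simp only [pairCorr, conn4, conn2, ω_shift, N.q_mean]
  ring

variable {v p : ℝ}

/-- Each term of `pairCorr_eq` decays in two distances whose difference no longer contains `x`. Half
of the power is kept to integrate over `x`, the other half controls `y' - y` (fourth cumulant and
direct pairing) or `y' + y` (crossed pairing). -/
lemma exists_pairCorr_bound (hcl : S.Clustering v p) (hv : 0 ≤ v) (hp : 0 ≤ p) (I : M) :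
    ∃ C : ℝ, 0 ≤ C ∧ ∀ y y' x : ℝ, ‖N.pairCorr I y y' x‖ ≤
      C * ((1 + |x|) ^ (-(p / 2)) * (1 + |y' - y|) ^ (-(p / 2))) +
      C * ((1 + |x + y|) ^ (-(p / 2)) * (1 + |y' + y|) ^ (-(p / 2))) := by
  obtain ⟨C₂, hC₂, H₂⟩ := hcl.exists_conn2_bound hv hp (N.q_mem I) (N.q_mem I) 0
  obtain ⟨C₄, hC₄, H₄⟩ := hcl.exists_conn4_bound hp (N.q_mem I)
  have hone : ∀ r : ℝ, (1 + |r|) ^ (-p) ≤ 1 := fun r =>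
    Real.rpow_le_one_of_one_le_of_nonpos (by linarith [abs_nonneg r]) (by linarith)
  have H₂' : ∀ x y, ‖S.conn2 (S.shift x 0 (N.q I)) (S.shift y 0 (N.q I))‖ ≤
      C₂ * (1 + |x - y|) ^ (-p) := fun x y => H₂ x y 0 0 (by simp) (by simp)
  have H₂'' : ∀ x y, ‖S.conn2 (S.shift x 0 (N.q I)) (S.shift y 0 (N.q I))‖ ≤ C₂ := fun x y =>
    (H₂' x y).trans (mul_le_of_le_one_right hC₂ (hone _))
  have hprod : ∀ x y x' y', ‖S.conn2 (S.shift x 0 (N.q I)) (S.shift y 0 (N.q I)) *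
      S.conn2 (S.shift x' 0 (N.q I)) (S.shift y' 0 (N.q I))‖ ≤
        C₂ * C₂ * (1 + |x - y|) ^ (-p) ∧
      ‖S.conn2 (S.shift x 0 (N.q I)) (S.shift y 0 (N.q I)) *
      S.conn2 (S.shift x' 0 (N.q I)) (S.shift y' 0 (N.q I))‖ ≤
        C₂ * C₂ * (1 + |x' - y'|) ^ (-p) := by
    intro x y x' y'
    rw [norm_mul]
    constructor
    · calc _ ≤ (C₂ * (1 + |x - y|) ^ (-p)) * C₂ :=
          mul_le_mul (H₂' _ _) (H₂'' _ _) (norm_nonneg _) (by positivity)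
        _ = _ := by ring
    · calc _ ≤ C₂ * (C₂ * (1 + |x' - y'|) ^ (-p)) :=
          mul_le_mul (H₂'' _ _) (H₂' _ _) (norm_nonneg _) (by positivity)
        _ = _ := by ring
  refine ⟨(C₄ + C₂ * C₂) * 2 ^ p, by positivity, fun y y' x => ?_⟩
  rw [pairCorr_eq]
  have e1 := le_mul_rpow_mul_rpow_sub (x := x) (x' := x + y - y') hC₄ hp
    (by simpa using H₄ ![x + y, x, 0, y'] 1 2 (by decide))
    (by simpa using H₄ ![x + y, x, 0, y'] 0 3 (by decide))
  have e2 := le_mul_rpow_mul_rpow_sub (x := x + y) (x' := x - y') (mul_nonneg hC₂ hC₂) hp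
    (by simpa only [sub_zero] using (hprod (x + y) 0 x y').1) (hprod (x + y) 0 x y').2
  have e3 := le_mul_rpow_mul_rpow_sub (x := x) (x' := x + y - y') (mul_nonneg hC₂ hC₂) hp
    (by simpa only [sub_zero] using (hprod (x + y) y' x 0).2) (hprod (x + y) y' x 0).1
  have r1 : x - (x + y - y') = y' - y := by ring
  have r2 : x + y - (x - y') = y' + y := by ring
  rw [r1] at e1 e3
  rw [r2] at e2
  refine norm_add₃_le.trans ((add_le_add (add_le_add e1 e2) e3).trans ?_)
  have h0 : 0 ≤ C₄ * 2 ^ p * ((1 + |x + y|) ^ (-(p / 2)) * (1 + |y' + y|) ^ (-(p / 2))) := by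
    positivity
  linarith

lemma continuous_pairCorr (I : M) : Continuous fun z : ℝ × ℝ × ℝ =>
    N.pairCorr I z.1 z.2.1 z.2.2 := by
  unfold pairCorr
  refine (S.continuous_ω_four _ _ _ _ ?_ ?_ ?_ ?_ ?_ ?_ ?_ ?_).sub
    ((S.continuous_ω_two _ _ ?_ ?_ ?_ ?_).mul (S.continuous_ω_two _ _ ?_ ?_ ?_ ?_)) <;> fun_prop

lemma continuous_pairCls (hcl : S.Clustering v p) (hv : 0 ≤ v) (hp : 2 < p) (I : M) :
    Continuous (N.pairCls I) := by
  refine continuous_of_continuous_inner ?_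
  simp only [inner_pairCls]
  obtain ⟨C, hC, H⟩ := N.exists_pairCorr_bound hcl hv (by linarith) I
  have hint := integrable_one_add_abs (r := p / 2) (by linarith)
  have hone : ∀ r : ℝ, (1 + |r|) ^ (-(p / 2)) ≤ 1 := fun r =>
    Real.rpow_le_one_of_one_le_of_nonpos (by linarith [abs_nonneg r]) (by linarith)
  rw [continuous_iff_continuousAt]
  intro z
  set B := ‖z‖ + 1 with hB
  have hB0 : 0 < B := by positivity
  refine continuousAt_of_dominated
    (bound := fun x => (C + C * (1 + B) ^ (p / 2)) * (1 + |x|) ^ (-(p / 2))) ?_ ?_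
    (hint.const_mul _) ?_
  · exact Eventually.of_forall fun w => ((N.continuous_pairCorr I).comp
      (f := fun x : ℝ => (w.1, w.2, x)) (by fun_prop)).aestronglyMeasurable
  · filter_upwards [Metric.ball_mem_nhds z one_pos] with w hw
    refine ae_of_all _ fun x => (H _ _ _).trans ?_
    have hw' : |w.1| ≤ B := by
      have := norm_sub_norm_le w z
      rw [mem_ball_iff_norm] at hw
      exact (norm_fst_le w).trans (by linarith)
    -- For bounded `w.1` the shift costs only a constant, which gives a dominating function
    -- independent of `w`.
    have h1 : (1 + |x + w.1|) ^ (-(p / 2)) ≤ (1 + B) ^ (p / 2) * (1 + |x|) ^ (-(p / 2)) := by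
      have h2 : (1 + |x|) / (1 + B) ≤ 1 + |x + w.1| := by
        rw [div_le_iff₀ (by positivity)]
        have := abs_sub (x + w.1) w.1
        rw [add_sub_cancel_right] at this
        nlinarith [abs_nonneg (x + w.1)]
      have h3 := Real.rpow_le_rpow_of_nonpos (z := -(p / 2)) (by positivity) h2 (by linarith)
      rw [Real.div_rpow (by positivity) (by positivity), Real.rpow_neg (by positivity : 0 ≤ 1 + B),
        div_inv_eq_mul] at h3
      linarith
    rw [add_mul, mul_assoc]
    refine add_le_add ?_ ?_
    · exact mul_le_mul_of_nonneg_left (mul_le_of_le_one_right (by positivity) (hone _)) hC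
    · exact mul_le_mul_of_nonneg_left ((mul_le_of_le_one_right (by positivity) (hone _)).trans h1)
        hC
  · exact ae_of_all _ fun x => ((N.continuous_pairCorr I).comp
      (f := fun w : ℝ × ℝ => (w.1, w.2, x)) (by fun_prop)).continuousAt

/-- The squared norm of `∫_{-L}^L dy q_I(0) q_I(y)` grows at most linearly. -/
lemma exists_norm_integral_pairCls_sq_le (hcl : S.Clustering v p) (hv : 0 ≤ v) (hp : 2 < p)
    (I : M) : ∃ C : ℝ, 0 ≤ C ∧ ∀ L : ℝ, 0 ≤ L →
      ‖∫ y in (-L)..L, N.pairCls I y‖ ^ 2 ≤ C * L := by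
  obtain ⟨C, hC, H⟩ := N.exists_pairCorr_bound hcl hv (by linarith) I
  have hF := N.continuous_pairCls hcl hv hp I
  set w : ℝ → ℝ := fun x => (1 + |x|) ^ (-(p / 2)) with hw
  have hint : Integrable w := integrable_one_add_abs (r := p / 2) (by linarith)
  have hw0 : ∀ x, 0 ≤ w x := fun x => by positivity
  set W := ∫ x, w x with hW
  have hW0 : 0 ≤ W := integral_nonneg hw0
  have hG : ∀ y y', ‖⟪N.pairCls I y, N.pairCls I y'⟫_ℂ‖ ≤ C * W * (w (y' - y) + w (y' + y)) := by
    intro y y'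
    rw [inner_pairCls]
    have h1 : Integrable fun x => C * (w x * w (y' - y)) := (hint.mul_const _).const_mul C
    have h2 : Integrable fun x => C * (w (x + y) * w (y' + y)) :=
      ((hint.comp_add_right y).mul_const _).const_mul C
    refine (norm_integral_le_of_norm_le (h1.add h2) (ae_of_all _ fun x => H y y' x)).trans_eq ?_
    simp only [Pi.add_apply]
    rw [integral_add h1 h2, integral_const_mul, integral_const_mul, integral_mul_const,
      integral_mul_const, integral_add_right_eq_self w y]
    ring
  refine ⟨C * W * (W + W) * 2, by positivity, fun L hL => ?_⟩
  -- The Gram kernel is integrable in `y'` uniformly in `y`, so only the outer integral grows with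
  -- `L`.
  have h1 : ∀ y, ‖⟪N.pairCls I y, ∫ y' in (-L)..L, N.pairCls I y'⟫_ℂ‖ ≤ C * W * (W + W) := by
    intro y
    have hi : Integrable fun y' => C * W * (w (y' - y) + w (y' + y)) :=
      ((hint.comp_sub_right y).add (hint.comp_add_right y)).const_mul _
    rw [inner_intervalIntegral_right hF, intervalIntegral.integral_of_le (by linarith)]
    refine (norm_integral_le_of_norm_le hi.integrableOn (ae_of_all _ fun y' => hG y y')).trans ?_
    refine (setIntegral_le_integral hi (ae_of_all _ fun y' => ?_)).trans_eq ?_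
    · have := hw0 (y' - y)
      have := hw0 (y' + y)
      simp only [Pi.zero_apply]
      positivity
    · rw [integral_const_mul, integral_add (hint.comp_sub_right y) (hint.comp_add_right y),
        integral_add_right_eq_self w y, integral_sub_right_eq_self w y]
  have h2 : ‖∫ y in (-L)..L, N.pairCls I y‖ ^ 2 =
      ‖⟪∫ y in (-L)..L, N.pairCls I y, ∫ y in (-L)..L, N.pairCls I y⟫_ℂ‖ := by
    rw [inner_self_eq_norm_sq_to_K]; simp
  rw [h2, inner_intervalIntegral_left hF]
  refine (intervalIntegral.norm_integral_le_of_norm_le_const fun y _ => h1 y).trans_eq ?_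
  rw [abs_of_nonneg (by linarith)]
  ring

/-- The overlap of `∫_{-L}^L dy q_I(0) q_I(y)` with the fluctuating current at time `t` is the
coupling, up to the weight of the three-point function away from the diagonal. -/
lemma norm_inner_integral_pairCls_sub_coupling_le (hcl : S.Clustering v p) (hv : 0 ≤ v)
    (hp : 2 < p) (I K : M) (t : ℝ) {L : ℝ} (hL : 0 ≤ L) :
    ‖⟪∫ y in (-L)..L, N.pairCls I y, S.τHydro t (S.cls (N.fluct K) (N.fluct_mem K))⟫_ℂ -
      N.coupling I K‖ ≤ ∫ z in {z : ℝ × ℝ | L ≤ |z.1 - z.2|},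
        ‖S.conn3 (S.shift z.1 0 (N.q I)) (S.shift z.2 0 (N.q I)) (S.shift 0 t (N.fluct K))‖ := by
  rw [inner_intervalIntegral_left (N.continuous_pairCls hcl hv hp I),
    ← N.integral_conn3_eq_coupling hcl hv hp I K t]
  simp only [inner_pairCls_τHydro]
  exact norm_integral_strip_sub_le
    (integrable_conn3_shift hcl hv hp (N.q_mem I) (N.q_mem I) (N.fluct_mem K) 0 0 t) hL

end NormalModes

end ManyBodySystem

/-! ### Integrals of weights away from the diagonal -/

/-- Splits a decay rate in two: the part `s - r` becomes smallness in the cutoff `ℓ`, the part `r`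
stays for integrability. -/
lemma rpow_neg_le_mul_rpow_neg {ℓ m s r : ℝ} (hℓ : 0 < ℓ) (hm : ℓ ≤ m) (hr : r ≤ s) :
    m ^ (-s) ≤ ℓ ^ (-(s - r)) * m ^ (-r) := by
  have hm0 : 0 < m := hℓ.trans_le hm
  have h : m ^ (-s) = m ^ (-(s - r)) * m ^ (-r) := by
    rw [← Real.rpow_add hm0]; congr 1; ring
  rw [h]
  have := Real.rpow_le_rpow_of_nonpos (z := -(s - r)) hℓ hm (by linarith)
  gcongr

/-- In the sup norm: wherever the trajectory is, the farther of two points lies at least half their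
separation away from it. -/
lemma half_abs_sub_le_norm (z : ℝ × ℝ) (c : ℝ) : |z.1 - z.2| / 2 ≤ ‖z + (c, c)‖ := by
  have h1 := norm_fst_le (z + (c, c))
  have h2 := norm_snd_le (z + (c, c))
  have h3 := abs_sub (z.1 + c) (z.2 + c)
  rw [add_sub_add_right_eq_sub] at h3
  simp only [Prod.fst_add, Prod.snd_add, Real.norm_eq_abs] at h1 h2
  linarith

lemma integrable_prod_one_add_norm {r : ℝ} (hr : 2 < r) (c : ℝ) :
    Integrable fun z : ℝ × ℝ => (1 + ‖z + (c, c)‖) ^ (-r) := by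
  have h : Integrable fun z : ℝ × ℝ => (1 + ‖z‖) ^ (-r) :=
    integrable_one_add_norm (by simpa using hr)
  exact h.comp_add_right (c, c)

lemma integral_prod_one_add_norm (r c : ℝ) :
    ∫ z : ℝ × ℝ, (1 + ‖z + (c, c)‖) ^ (-r) = ∫ z : ℝ × ℝ, (1 + ‖z‖) ^ (-r) :=
  integral_add_right_eq_self (fun z : ℝ × ℝ => (1 + ‖z‖) ^ (-r)) (c, c)

/-- A weight in `z.1 - z.2`, restricted to `|z.2| ≤ b`. -/
lemma integral_indicator_mul_sub {g : ℝ → ℝ} (hg : Integrable g) {b : ℝ} (hb : 0 ≤ b) :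
    Integrable (fun z : ℝ × ℝ => (Icc (-b) b).indicator 1 z.2 * g (z.1 - z.2)) ∧
      ∫ z : ℝ × ℝ, (Icc (-b) b).indicator 1 z.2 * g (z.1 - z.2) = 2 * b * ∫ x, g x := by
  have hi : Integrable ((Icc (-b) b).indicator (1 : ℝ → ℝ)) :=
    (integrable_indicator_iff measurableSet_Icc).2
      (integrableOn_const (by simp) (by simp))
  have hcomp : ∀ z : ℝ × ℝ, (Icc (-b) b).indicator (1 : ℝ → ℝ) z.2 * g (z.2 + z.1 - z.2) =
      g z.1 * (Icc (-b) b).indicator 1 z.2 := fun z => by rw [add_sub_cancel_left, mul_comm]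
  rw [Measure.volume_eq_prod]
  constructor
  · rw [← measurePreserving_shear.integrable_comp_emb measurableEmbedding_shear]
    refine (hg.mul_prod hi).congr (ae_of_all _ fun z => (hcomp z).symm)
  · rw [← measurePreserving_shear.integral_comp measurableEmbedding_shear]
    simp only [hcomp]
    rw [integral_prod_mul, integral_indicator measurableSet_Icc]
    simp only [Pi.one_apply, integral_const, smul_eq_mul, mul_one, measureReal_restrict_apply_univ,
      Real.volume_real_Icc_of_le (by linarith : -b ≤ b)]
    ring

namespace ManyBodySystem.NormalModes

variable {𝔄 : Type*} [Ring 𝔄] [StarRing 𝔄] [Algebra ℂ 𝔄] [StarModule ℂ 𝔄]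
variable {S : ManyBodySystem 𝔄} {M : Type*} (N : S.NormalModes M) {v p : ℝ}

/-! ### The three-point function away from the diagonal -/

/-- The alternatives are the three ways to isolate one point. The densities are at equal times, so
the cone condition only concerns their positions relative to the current. -/
lemma exists_conn3_bound_of_split (hcl : S.Clustering v p) (I K : M) :
    ∃ C : ℝ, 0 ≤ C ∧ ∀ a b t D : ℝ, 0 ≤ D →
      ((D ≤ |a| ∧ v * |t| ≤ |a| ∧ D ≤ |a - b|) ∨ (D ≤ |b| ∧ v * |t| ≤ |b| ∧ D ≤ |a - b|) ∨
        (D ≤ |a| ∧ D ≤ |b| ∧ v * |t| ≤ |a| ∧ v * |t| ≤ |b|)) →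
      ‖S.conn3 (S.shift a 0 (N.q I)) (S.shift b 0 (N.q I)) (S.shift 0 t (N.fluct K))‖ ≤
        C * (1 + D) ^ (-p) := by
  obtain ⟨C, H⟩ := hcl.2.1 ![N.q I, N.q I, N.fluct K] (by
    intro i
    fin_cases i
    · exact N.q_mem I
    · exact N.q_mem I
    · exact N.fluct_mem K)
  refine ⟨|C|, abs_nonneg C, fun a b t D hD h => ?_⟩
  refine le_trans ?_ (mul_le_mul_of_nonneg_right (le_abs_self C) (by positivity))
  rcases h with ⟨h1, h2, h3⟩ | ⟨h1, h2, h3⟩ | ⟨h1, h2, h3, h4⟩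
  · refine H ![a, b, 0] ![0, 0, t] {0} D ⟨0, rfl⟩ ⟨1, by simp⟩ hD ?_
    rintro i rfl j hj
    fin_cases j
    · exact absurd rfl hj
    · simpa using h3
    · simpa using And.intro h1 h2
  · refine H ![a, b, 0] ![0, 0, t] {1} D ⟨1, rfl⟩ ⟨0, by simp⟩ hD ?_
    rintro i rfl j hj
    fin_cases j
    · simpa [abs_sub_comm] using h3
    · exact absurd rfl hj
    · simpa using And.intro h1 h2
  · refine H ![a, b, 0] ![0, 0, t] {2} D ⟨2, rfl⟩ ⟨0, by simp⟩ hD ?_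
    rintro i rfl j hj
    fin_cases j
    · simpa using And.intro h1 h3
    · simpa using And.intro h2 h4
    · exact absurd rfl hj

/-- Bounds on the three-point function outside the cone of velocity `v`. -/
lemma exists_conn3_bound_outside (hcl : S.Clustering v p) (hp : 0 ≤ p) (I K : M) :
    ∃ C : ℝ, 0 ≤ C ∧ ∀ a b t : ℝ, ¬ (|a| ≤ v * |t| ∧ |b| ≤ v * |t|) →
      ‖S.conn3 (S.shift a 0 (N.q I)) (S.shift b 0 (N.q I)) (S.shift 0 t (N.fluct K))‖ ≤
        C * (1 + ‖(a, b)‖) ^ (-p) +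
        C * ((Icc (-(v * |t|)) (v * |t|)).indicator 1 b * (1 + |a - b|) ^ (-p)) +
        C * ((Icc (-(v * |t|)) (v * |t|)).indicator 1 a * (1 + |b - a|) ^ (-p)) := by
  obtain ⟨C, hC, H⟩ := N.exists_conn3_bound_of_split hcl I K
  have hhalf : ∀ {e D : ℝ}, 0 ≤ D → e ≤ C * (1 + D / 2) ^ (-p) →
      e ≤ C * 2 ^ p * (1 + D) ^ (-p) := by
    intro e D hD he
    have := one_add_div_rpow_neg_le (n := 2) (by norm_num) hD hp
    calc e ≤ _ := he
      _ ≤ C * (2 ^ p * (1 + D) ^ (-p)) := by gcongr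
      _ = _ := by ring
  refine ⟨C * 2 ^ p, by positivity, fun a b t hout => ?_⟩
  set E := ‖S.conn3 (S.shift a 0 (N.q I)) (S.shift b 0 (N.q I)) (S.shift 0 t (N.fluct K))‖
  have hind : ∀ c : ℝ, 0 ≤ (Icc (-(v * |t|)) (v * |t|)).indicator (1 : ℝ → ℝ) c := fun c =>
    indicator_nonneg (fun _ _ => zero_le_one) c
  have n1 : 0 ≤ C * 2 ^ p * (1 + ‖(a, b)‖) ^ (-p) := by positivity
  have n2 : 0 ≤ C * 2 ^ p *
      ((Icc (-(v * |t|)) (v * |t|)).indicator 1 b * (1 + |a - b|) ^ (-p)) := by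
    have := hind b
    positivity
  have n3 : 0 ≤ C * 2 ^ p *
      ((Icc (-(v * |t|)) (v * |t|)).indicator 1 a * (1 + |b - a|) ^ (-p)) := by
    have := hind a
    positivity
  have hsub := abs_sub a b
  by_cases hb : |b| ≤ v * |t|
  · have ha : v * |t| ≤ |a| := by
      by_contra! ha
      exact hout ⟨ha.le, hb⟩
    -- Here `|b| ≤ |a|`, hence `|a - b| / 2 ≤ |a|`, and the density at `a` is isolated.
    have h1 : E ≤ C * 2 ^ p * (1 + |a - b|) ^ (-p) :=
      hhalf (abs_nonneg _) (H a b t (|a - b| / 2) (by positivity)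
        (Or.inl ⟨by linarith, ha, by linarith [abs_nonneg (a - b)]⟩))
    have h2 : (Icc (-(v * |t|)) (v * |t|)).indicator (1 : ℝ → ℝ) b = 1 := by
      rw [indicator_of_mem (mem_Icc.2 (abs_le.1 hb)), Pi.one_apply]
    rw [h2, one_mul] at n2 ⊢
    linarith
  · push Not at hb
    by_cases ha : |a| ≤ v * |t|
    · have h1 : E ≤ C * 2 ^ p * (1 + |b - a|) ^ (-p) := by
        rw [abs_sub_comm b a]
        exact hhalf (abs_nonneg _) (H a b t (|a - b| / 2) (by positivity)
          (Or.inr (Or.inl ⟨by linarith, hb.le, by linarith [abs_nonneg (a - b)]⟩)))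
      have h2 : (Icc (-(v * |t|)) (v * |t|)).indicator (1 : ℝ → ℝ) a = 1 := by
        rw [indicator_of_mem (mem_Icc.2 (abs_le.1 ha)), Pi.one_apply]
      rw [h2, one_mul] at n3 ⊢
      linarith
    · push Not at ha
      have h1 : E ≤ C * 2 ^ p * (1 + ‖(a, b)‖) ^ (-p) := by
        refine hhalf (norm_nonneg _) (H a b t (‖(a, b)‖ / 2) (by positivity) ?_)
        rw [Prod.norm_def]
        simp only [Real.norm_eq_abs]
        have h3 := abs_sub_abs_le_abs_sub a b
        have h4 := abs_sub_abs_le_abs_sub b a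
        rw [abs_sub_comm b a] at h4
        have := abs_nonneg a
        have := abs_nonneg b
        -- If `|a|` and `|b|` agree up to a factor two, the current is isolated. Otherwise the
        -- farther density is, since it is also far from the other one.
        rcases le_total |b| |a| with hab | hab
        · rw [max_eq_left hab]
          by_cases h5 : |a| / 2 ≤ |b|
          · exact Or.inr (Or.inr ⟨by linarith, h5, ha.le, hb.le⟩)
          · exact Or.inl ⟨by linarith, ha.le, by linarith⟩
        · rw [max_eq_right hab]
          by_cases h5 : |b| / 2 ≤ |a|
          · exact Or.inr (Or.inr ⟨h5, by linarith, ha.le, hb.le⟩)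
          · exact Or.inr (Or.inl ⟨by linarith, hb.le, by linarith⟩)
      linarith

/-- Inside the cone, all terms of the superdiffusive clustering are controlled by the one with the
smallest exponent, in terms of the distance of the farther density to the trajectory. -/
lemma SuperClustering.exists_bound {N : S.NormalModes M} {I K : M} {α u : ℝ}
    (h : N.SuperClustering v I K α) (hv : 0 < v) (hu : α + 1 < u) (hu' : u < 2) (hα : 0 < α) :
    ∃ k C R : ℝ, 0 < k ∧ 0 ≤ C ∧ 0 < R ∧ ∀ a b t ℓ : ℝ, R ≤ |t| → 1 ≤ ℓ →
      k * |t| ^ (u - 1) ≤ ℓ → 2 * ℓ ≤ |a - b| → |a| ≤ v * |t| → |b| ≤ v * |t| →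
      ‖S.conn3 (S.shift a 0 (N.q I)) (S.shift b 0 (N.q I)) (S.shift 0 t (N.fluct K))‖ ≤
        C * (|t| * (1 + ‖(a, b) + (N.vel I * t, N.vel I * t)‖) ^ (-(2 + 1 / α))) := by
  obtain ⟨κ, C, R, F, hκ, hR, hF, H⟩ := h u hu hu'
  set c : ℝ := v + |N.vel I| with hc
  have hc0 : 0 < c := by positivity
  set s : ℝ := 2 + 1 / α with hs
  have hs0 : 0 ≤ s := by positivity
  refine ⟨κ ^ (u - 1), |C| * (∑ ν ∈ F, c ^ (ν + 1)) * 2 ^ s, R, by positivity, ?_, hR, ?_⟩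
  · have : 0 ≤ ∑ ν ∈ F, c ^ (ν + 1) := Finset.sum_nonneg fun ν _ => by positivity
    positivity
  intro a b t ℓ ht hℓ hkℓ hab ha hb
  have ht0 : 0 < |t| := hR.trans_le ht
  -- Taking adjoints reverses the operator order, which the clustering assumption fixes with the
  -- current in front.
  have hconj : ‖S.conn3 (S.shift a 0 (N.q I)) (S.shift b 0 (N.q I))
      (S.shift 0 t (N.fluct K))‖ = ‖S.conn3 (S.shift 0 t (N.fluct K)) (S.shift b 0 (N.q I))
      (S.shift a 0 (N.q I))‖ := by
    rw [← norm_star, star_conn3, star_shift, star_shift, star_shift, (N.q_sa I).star_eq,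
      (N.fluct_sa K).star_eq]
  set m := ‖(a, b) + (N.vel I * t, N.vel I * t)‖ with hm
  have hm_eq : m = max |a + N.vel I * t| |b + N.vel I * t| := by
    rw [hm, Prod.norm_def]; rfl
  have hmℓ : ℓ ≤ m := le_trans (by linarith) (half_abs_sub_le_norm (a, b) (N.vel I * t))
  have hm1 : 1 ≤ m := hℓ.trans hmℓ
  have hm0 : 0 < m := by linarith
  have hκm : |κ * t| ^ (u - 1) ≤ m := by
    rw [abs_mul, abs_of_pos hκ, Real.mul_rpow hκ.le (abs_nonneg t)]
    exact hkℓ.trans hmℓ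
  have hbound : ‖S.conn3 (S.shift 0 t (N.fluct K)) (S.shift b 0 (N.q I))
      (S.shift a 0 (N.q I))‖ ≤ C * ∑ ν ∈ F, |t| ^ (-ν) * m ^ (ν - 1 / α - 1) := by
    have hcone : ∀ i, |0 - (![b, a] : Fin 2 → ℝ) i| ≤ v * |t| := by
      intro i
      fin_cases i
      · simpa using hb
      · simpa using ha
    have hi : ∃ i, |0 - (![b, a] : Fin 2 → ℝ) i - N.vel I * t| = m := by
      rcases le_total |a + N.vel I * t| |b + N.vel I * t| with hle | hle
      · refine ⟨0, ?_⟩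
        rw [hm_eq, max_eq_right hle, ← abs_neg]
        simp [add_comm]
      · refine ⟨1, ?_⟩
        rw [hm_eq, max_eq_left hle, ← abs_neg]
        simp [add_comm]
    obtain ⟨i, hi⟩ := hi
    have := H 0 t ![b, a] ht hcone i (by rw [hi]; exact hκm)
    rwa [hi] at this
  have hmc : m ≤ c * |t| := by
    rw [hm_eq]
    refine max_le ?_ ?_
    · refine (abs_add_le _ _).trans ?_
      rw [abs_mul, hc, add_mul]; linarith
    · refine (abs_add_le _ _).trans ?_
      rw [abs_mul, hc, add_mul]; linarith
  -- Since `m ≤ c * |t|` inside the cone and `ν ≥ -1`, raising `ν` above `-1` only contributes a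
  -- power of the bounded ratio `m / |t|`; the term `ν = -1` dominates.
  have hterm : ∀ ν ∈ F, |t| ^ (-ν) * m ^ (ν - 1 / α - 1) ≤ c ^ (ν + 1) * (|t| * m ^ (-s)) := by
    intro ν hν
    have h1 : m ^ (ν - 1 / α - 1) = m ^ (ν + 1) * m ^ (-s) := by
      rw [← Real.rpow_add hm0, hs]; congr 1; ring
    have h2 : |t| ^ (-ν) = |t| * |t| ^ (-(ν + 1)) := by
      nth_rewrite 2 [← Real.rpow_one |t|]
      rw [← Real.rpow_add ht0]; congr 1; ring
    have h3 : m ^ (ν + 1) ≤ c ^ (ν + 1) * |t| ^ (ν + 1) := by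
      rw [← Real.mul_rpow hc0.le ht0.le]
      exact Real.rpow_le_rpow hm0.le hmc (by linarith [hF ν hν])
    have h4 : |t| ^ (-(ν + 1)) * |t| ^ (ν + 1) = 1 := by
      rw [← Real.rpow_add ht0, neg_add_cancel, Real.rpow_zero]
    rw [h1, h2]
    calc |t| * |t| ^ (-(ν + 1)) * (m ^ (ν + 1) * m ^ (-s))
        ≤ |t| * |t| ^ (-(ν + 1)) * (c ^ (ν + 1) * |t| ^ (ν + 1) * m ^ (-s)) := by gcongr
      _ = (|t| ^ (-(ν + 1)) * |t| ^ (ν + 1)) * (c ^ (ν + 1) * (|t| * m ^ (-s))) := by ring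
      _ = _ := by rw [h4, one_mul]
  have hms : m ^ (-s) ≤ 2 ^ s * (1 + m) ^ (-s) := by
    have h1 : (1 + m) / 2 ≤ m := by linarith
    have h2 := Real.rpow_le_rpow_of_nonpos (z := -s) (by positivity) h1 (by linarith)
    rw [Real.div_rpow (by positivity) (by norm_num), Real.rpow_neg (by norm_num : (0 : ℝ) ≤ 2),
      div_inv_eq_mul] at h2
    linarith
  rw [hconj]
  calc _ ≤ _ := hbound
    _ ≤ |C| * ∑ ν ∈ F, |t| ^ (-ν) * m ^ (ν - 1 / α - 1) :=
      mul_le_mul_of_nonneg_right (le_abs_self C) (Finset.sum_nonneg fun ν _ => by positivity)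
    _ ≤ |C| * ∑ ν ∈ F, c ^ (ν + 1) * (|t| * m ^ (-s)) :=
      mul_le_mul_of_nonneg_left (Finset.sum_le_sum hterm) (abs_nonneg C)
    _ = |C| * (∑ ν ∈ F, c ^ (ν + 1)) * (|t| * m ^ (-s)) := by
      rw [← Finset.sum_mul, mul_assoc]
    _ ≤ |C| * (∑ ν ∈ F, c ^ (ν + 1)) * (|t| * (2 ^ s * (1 + m) ^ (-s))) := by
      have : 0 ≤ ∑ ν ∈ F, c ^ (ν + 1) := Finset.sum_nonneg fun ν _ => by positivity
      gcongr
    _ = _ := by ring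

end ManyBodySystem.NormalModes

/-! ### Tails off the strip, overlap with the current, and the lower norm -/

lemma tendsto_mul_rpow_rpow_neg {k e β : ℝ} (hk : 0 < k) (h : 1 < e * β) :
    Tendsto (fun T : ℝ => T * (k * T ^ e) ^ (-β)) atTop (𝓝 0) := by
  have h1 : Tendsto (fun T : ℝ => k ^ (-β) * T ^ (-(e * β - 1))) atTop (𝓝 0) := by
    simpa using (tendsto_rpow_neg_atTop (by linarith : 0 < e * β - 1)).const_mul (k ^ (-β))
  refine h1.congr' ((eventually_gt_atTop 0).mono fun T hT => ?_)
  have h2 : T ^ (-(e * β - 1)) = T * T ^ (e * -β) := by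
    nth_rewrite 2 [← Real.rpow_one T]
    rw [← Real.rpow_add hT]; congr 1; ring
  beta_reduce
  rw [Real.mul_rpow hk.le (by positivity), ← Real.rpow_mul hT.le, h2]
  ring

namespace ManyBodySystem.NormalModes

variable {𝔄 : Type*} [Ring 𝔄] [StarRing 𝔄] [Algebra ℂ 𝔄] [StarModule ℂ 𝔄]
variable {S : ManyBodySystem 𝔄} {M : Type*} {N : S.NormalModes M} {v p : ℝ}

/-- The weight of the three-point function off the strip `|y₁ - y₂| < 2 k T ^ (u - 1)` vanishes as
`T → ∞`, uniformly for times `R ≤ |t| ≤ T`. -/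
lemma SuperClustering.exists_tail_bound {I K : M} {α u : ℝ} (h : N.SuperClustering v I K α)
    (hcl : S.Clustering v p) (hv : 0 < v) (hp : 3 < p) (hα : α ∈ Ioo (1 / 2 : ℝ) 1)
    (hu : α + 1 < u) (hu' : u < 2) :
    ∃ k R : ℝ, 0 < k ∧ 0 < R ∧ ∃ ε : ℝ → ℝ, Tendsto ε atTop (𝓝 0) ∧
      ∀ᶠ T in atTop, ∀ t : ℝ, R ≤ |t| → |t| ≤ T →
        ∫ z in {z : ℝ × ℝ | 2 * (k * T ^ (u - 1)) ≤ |z.1 - z.2|},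
          ‖S.conn3 (S.shift z.1 0 (N.q I)) (S.shift z.2 0 (N.q I))
            (S.shift 0 t (N.fluct K))‖ ≤ ε T := by
  have hα0 : 0 < α := by linarith [hα.1]
  obtain ⟨k, C₁, R, hk, hC₁, hR, H₁⟩ := h.exists_bound hv hu hu' hα0
  obtain ⟨C₂, hC₂, H₂⟩ := N.exists_conn3_bound_outside hcl (by linarith) I K
  set e : ℝ := u - 1 with he
  have heα : α < e := by linarith
  have he0 : 0 < e := by linarith
  have hinv : 1 / e < 1 / α := one_div_lt_one_div_of_lt hα0 heα
  -- The midpoint serves both needs: `β < 1 / α` leaves a planar-integrable power `r > 2`, and `β >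
  -- 1 / e` makes `T * (k * T ^ e) ^ (-β)` vanish.
  set β : ℝ := (1 / α + 1 / e) / 2 with hβ
  set r : ℝ := 2 + 1 / α - β with hr
  have hr2 : 2 < r := by linarith
  have heβ : 1 < e * β := by
    have : e * (1 / e) < e * β := mul_lt_mul_of_pos_left (by linarith) he0
    rwa [mul_one_div_cancel he0.ne'] at this
  set W₁ : ℝ := ∫ z : ℝ × ℝ, (1 + ‖z‖) ^ (-r) with hW₁
  set W₂ : ℝ := ∫ z : ℝ × ℝ, (1 + ‖z‖) ^ (-(3 : ℝ)) with hW₂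
  set W₃ : ℝ := ∫ x : ℝ, (1 + |x|) ^ (-(p - 2)) with hW₃
  have hW₁0 : 0 ≤ W₁ := integral_nonneg fun z => by positivity
  have hW₃0 : 0 ≤ W₃ := integral_nonneg fun z => by positivity
  -- The three errors come from both densities inside the cone, both outside, and exactly one
  -- inside. The last has an area factor proportional to `T` against `ℓ ^ (-2)`, and vanishes
  -- because `e > α > 1 / 2`.
  refine ⟨k, R, hk, hR, fun T => C₁ * W₁ * (T * (k * T ^ e) ^ (-β)) +
    C₂ * W₂ * (k * T ^ e) ^ (-(p - 3)) + 4 * C₂ * v * W₃ * (T * (k * T ^ e) ^ (-(2 : ℝ))), ?_, ?_⟩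
  · have t1 := (tendsto_mul_rpow_rpow_neg hk heβ).const_mul (C₁ * W₁)
    have t2 : Tendsto (fun T : ℝ => (k * T ^ e) ^ (-(p - 3))) atTop (𝓝 0) :=
      (tendsto_rpow_neg_atTop (by linarith)).comp ((tendsto_rpow_atTop he0).const_mul_atTop hk)
    have t3 := (tendsto_mul_rpow_rpow_neg hk
      (by linarith [hα.1] : 1 < e * 2)).const_mul (4 * C₂ * v * W₃)
    simpa using (t1.add (t2.const_mul (C₂ * W₂))).add t3
  have hℓ1 : ∀ᶠ T : ℝ in atTop, 1 ≤ k * T ^ e :=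
    ((tendsto_rpow_atTop he0).const_mul_atTop hk).eventually_ge_atTop 1
  filter_upwards [hℓ1, eventually_gt_atTop 0] with T hℓ hT t hRt htT
  set ℓ : ℝ := k * T ^ e with hℓdef
  have hℓ0 : 0 < ℓ := by linarith
  set c : ℝ := N.vel I * t with hc
  set g : ℝ → ℝ := fun x => (1 + |x|) ^ (-(p - 2)) with hg
  have hgi : Integrable g := integrable_one_add_abs (by linarith)
  obtain ⟨hi3, hI3⟩ := integral_indicator_mul_sub hgi (by positivity : 0 ≤ v * |t|)
  set χ : ℝ → ℝ := (Icc (-(v * |t|)) (v * |t|)).indicator 1 with hχ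
  have hχ0 : ∀ x, 0 ≤ χ x := fun x => indicator_nonneg (fun _ _ => zero_le_one) x
  have hi4 : Integrable fun z : ℝ × ℝ => χ z.1 * g (z.2 - z.1) := by
    rw [Measure.volume_eq_prod] at hi3 ⊢
    exact hi3.swap
  have hI4 : ∫ z : ℝ × ℝ, χ z.1 * g (z.2 - z.1) = 2 * (v * |t|) * W₃ := by
    rw [hW₃, ← hI3, Measure.volume_eq_prod,
      ← integral_prod_swap fun z : ℝ × ℝ => χ z.2 * g (z.1 - z.2)]
    rfl
  have hi1 := integrable_prod_one_add_norm hr2 c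
  have hi2 : Integrable fun z : ℝ × ℝ => (1 + ‖z‖) ^ (-(3 : ℝ)) := by
    simpa only [Prod.mk_zero_zero, add_zero] using
      integrable_prod_one_add_norm (by norm_num : (2 : ℝ) < 3) 0
  set G : ℝ × ℝ → ℝ := fun z => C₁ * (T * ℓ ^ (-β)) * (1 + ‖z + (c, c)‖) ^ (-r) +
    C₂ * ℓ ^ (-(p - 3)) * (1 + ‖z‖) ^ (-(3 : ℝ)) +
    C₂ * ℓ ^ (-(2 : ℝ)) * (χ z.2 * g (z.1 - z.2)) +
    C₂ * ℓ ^ (-(2 : ℝ)) * (χ z.1 * g (z.2 - z.1)) with hG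
  have m1 := hi1.const_mul (C₁ * (T * ℓ ^ (-β)))
  have m2 := hi2.const_mul (C₂ * ℓ ^ (-(p - 3)))
  have m3 := hi3.const_mul (C₂ * ℓ ^ (-(2 : ℝ)))
  have m4 := hi4.const_mul (C₂ * ℓ ^ (-(2 : ℝ)))
  have hGi : Integrable G := ((m1.add m2).add m3).add m4
  have n1 : ∀ z : ℝ × ℝ, 0 ≤ C₁ * (T * ℓ ^ (-β)) * (1 + ‖z + (c, c)‖) ^ (-r) := fun z => by
    positivity
  have n2 : ∀ z : ℝ × ℝ, 0 ≤ C₂ * ℓ ^ (-(p - 3)) * (1 + ‖z‖) ^ (-(3 : ℝ)) := fun z => by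
    positivity
  have n3 : ∀ z : ℝ × ℝ, 0 ≤ C₂ * ℓ ^ (-(2 : ℝ)) * (χ z.2 * g (z.1 - z.2)) := fun z => by
    have := hχ0 z.2
    positivity
  have n4 : ∀ z : ℝ × ℝ, 0 ≤ C₂ * ℓ ^ (-(2 : ℝ)) * (χ z.1 * g (z.2 - z.1)) := fun z => by
    have := hχ0 z.1
    positivity
  have hpt : ∀ z ∈ {z : ℝ × ℝ | 2 * ℓ ≤ |z.1 - z.2|},
      ‖S.conn3 (S.shift z.1 0 (N.q I)) (S.shift z.2 0 (N.q I))
        (S.shift 0 t (N.fluct K))‖ ≤ G z := by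
    rintro ⟨a, b⟩ hab
    simp only [mem_ofPred_eq] at hab
    by_cases hin : |a| ≤ v * |t| ∧ |b| ≤ v * |t|
    · have hkℓ : k * |t| ^ e ≤ ℓ := by
        rw [hℓdef]
        gcongr
      have h1 := H₁ a b t ℓ hRt hℓ hkℓ hab hin.1 hin.2
      have h2 : ℓ ≤ 1 + ‖(a, b) + (c, c)‖ := by
        have := half_abs_sub_le_norm (a, b) c
        simp only at this
        linarith
      have h3 := rpow_neg_le_mul_rpow_neg (s := 2 + 1 / α) (r := r) hℓ0 h2 (by
        have : 0 < β := by positivity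
        linarith)
      rw [show 2 + 1 / α - r = β by rw [hr]; ring] at h3
      have h4 : C₁ * (|t| * (1 + ‖(a, b) + (c, c)‖) ^ (-(2 + 1 / α))) ≤
          C₁ * (T * ℓ ^ (-β)) * (1 + ‖(a, b) + (c, c)‖) ^ (-r) := by
        calc _ ≤ C₁ * (T * (ℓ ^ (-β) * (1 + ‖(a, b) + (c, c)‖) ^ (-r))) := by gcongr
          _ = _ := by ring
      have := n2 (a, b)
      have := n3 (a, b)
      have := n4 (a, b)
      rw [hG]
      simp only at *
      linarith
    · have h1 := H₂ a b t hin
      have h2 : ℓ ≤ 1 + ‖(a, b)‖ := by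
        have := half_abs_sub_le_norm (a, b) 0
        simp only [Prod.mk_zero_zero, add_zero] at this
        linarith
      have h3 := rpow_neg_le_mul_rpow_neg (s := p) (r := 3) hℓ0 h2 hp.le
      have hd : ∀ x : ℝ, 2 * ℓ ≤ |x| → (1 + |x|) ^ (-p) ≤ ℓ ^ (-(2 : ℝ)) * g x := by
        intro x hx
        have := rpow_neg_le_mul_rpow_neg (s := p) (r := p - 2) hℓ0
          (by linarith : ℓ ≤ 1 + |x|) (by linarith)
        rwa [sub_sub_cancel] at this
      have h4 := hd _ hab
      have h5 := hd (b - a) (by rwa [abs_sub_comm])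
      have := n1 (a, b)
      have k1 : C₂ * (1 + ‖(a, b)‖) ^ (-p) ≤ C₂ * ℓ ^ (-(p - 3)) * (1 + ‖(a, b)‖) ^ (-(3 : ℝ)) := by
        rw [mul_assoc]; gcongr
      have k2 : C₂ * (χ b * (1 + |a - b|) ^ (-p)) ≤
          C₂ * ℓ ^ (-(2 : ℝ)) * (χ b * g (a - b)) := by
        calc _ ≤ C₂ * (χ b * (ℓ ^ (-(2 : ℝ)) * g (a - b))) :=
              mul_le_mul_of_nonneg_left (mul_le_mul_of_nonneg_left h4 (hχ0 b)) hC₂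
          _ = _ := by ring
      have k3 : C₂ * (χ a * (1 + |b - a|) ^ (-p)) ≤
          C₂ * ℓ ^ (-(2 : ℝ)) * (χ a * g (b - a)) := by
        calc _ ≤ C₂ * (χ a * (ℓ ^ (-(2 : ℝ)) * g (b - a))) :=
              mul_le_mul_of_nonneg_left (mul_le_mul_of_nonneg_left h5 (hχ0 a)) hC₂
          _ = _ := by ring
      rw [hG]
      simp only at *
      linarith
  have hs : MeasurableSet {z : ℝ × ℝ | 2 * ℓ ≤ |z.1 - z.2|} :=
    measurableSet_le measurable_const (by fun_prop)
  have hΦi := (integrable_conn3_shift hcl hv.le (by linarith) (N.q_mem I) (N.q_mem I)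
    (N.fluct_mem K) 0 0 t).norm
  calc _ ≤ ∫ z in {z : ℝ × ℝ | 2 * ℓ ≤ |z.1 - z.2|}, G z :=
        setIntegral_mono_on hΦi.integrableOn hGi.integrableOn hs hpt
    _ ≤ ∫ z, G z := setIntegral_le_integral hGi (ae_of_all _ fun z => by
        have := n1 z
        have := n2 z
        have := n3 z
        have := n4 z
        rw [hG]
        simp only [Pi.zero_apply] at *
        linarith)
    _ = C₁ * (T * ℓ ^ (-β)) * W₁ + C₂ * ℓ ^ (-(p - 3)) * W₂ +
        C₂ * ℓ ^ (-(2 : ℝ)) * (2 * (v * |t|) * W₃) +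
        C₂ * ℓ ^ (-(2 : ℝ)) * (2 * (v * |t|) * W₃) := by
        refine (integral_add' ((m1.add m2).add m3) m4).trans ?_
        rw [integral_add' (m1.add m2) m3, integral_add' m1 m2, integral_const_mul,
          integral_const_mul, integral_const_mul, integral_const_mul, hI3, hI4,
          integral_prod_one_add_norm]
    _ ≤ C₁ * (T * ℓ ^ (-β)) * W₁ + C₂ * ℓ ^ (-(p - 3)) * W₂ +
        C₂ * ℓ ^ (-(2 : ℝ)) * (2 * (v * T) * W₃) +
        C₂ * ℓ ^ (-(2 : ℝ)) * (2 * (v * T) * W₃) := by gcongr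
    _ = _ := by ring

/-- The overlap of `∫_{-L}^L dy q_I(0) q_I(y)`, `L = 2 k T ^ (u - 1)`, with the time-integrated
fluctuating current grows linearly in time. -/
lemma SuperClustering.exists_overlap_bound {I K : M} {α u : ℝ} (h : N.SuperClustering v I K α)
    (hcl : S.Clustering v p) (hv : 0 < v) (hp : 3 < p) (hα : α ∈ Ioo (1 / 2 : ℝ) 1)
    (hu : α + 1 < u) (hu' : u < 2) (hne : N.coupling I K ≠ 0) :
    ∃ k : ℝ, 0 < k ∧ ∀ᶠ T in atTop, ‖N.coupling I K‖ * T ≤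
      ‖⟪∫ y in (-(2 * (k * T ^ (u - 1))))..(2 * (k * T ^ (u - 1))), N.pairCls I y,
        ∫ t in (-T)..T, S.oneSubProj (S.τHydro t (N.current K))⟫_ℂ‖ := by
  obtain ⟨k, R, hk, hR, ε, hε, H⟩ := h.exists_tail_bound hcl hv hp hα hu hu'
  obtain ⟨C, hC, H'⟩ := exists_conn3_prod_bound hcl hv.le (by linarith) (N.q_mem I) (N.q_mem I)
    (N.fluct_mem K) R
  have hpi := integrable_one_add_abs (r := p / 2) (by linarith)
  set B : ℝ := ∫ z : ℝ × ℝ, C * ((1 + |z.1|) ^ (-(p / 2)) * (1 + |z.2|) ^ (-(p / 2))) with hB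
  have hBi : Integrable fun z : ℝ × ℝ =>
      C * ((1 + |z.1|) ^ (-(p / 2)) * (1 + |z.2|) ^ (-(p / 2))) := (hpi.mul_prod hpi).const_mul C
  set c := N.coupling I K with hc
  have hc0 : 0 < ‖c‖ := norm_pos_iff.2 hne
  refine ⟨k, hk, ?_⟩
  have hε' : ∀ᶠ T in atTop, ε T < ‖c‖ / 4 := hε.eventually_lt_const (by positivity)
  -- The last threshold makes the error `2 * R * B` from times `|t| ≤ R` at most `‖c‖ * T / 2`. The
  -- remaining times contribute no more than that again, against the main term `2 * T * ‖c‖`.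
  filter_upwards [H, hε', eventually_ge_atTop R, eventually_ge_atTop (4 * (R * B) / ‖c‖)]
    with T hT hεT hRT hBT
  have hT0 : 0 < T := hR.trans_le hRT
  set L : ℝ := 2 * (k * T ^ (u - 1)) with hL
  have hL0 : 0 ≤ L := by positivity
  set w : S.HydroSpace := ∫ y in (-L)..L, N.pairCls I y with hw
  simp only [N.oneSubProj_τHydro_current]
  have hcont := continuous_τHydro_cls hcl hv.le (by linarith) (N.fluct_mem K)
  rw [inner_intervalIntegral_right hcont]
  set g : ℝ → ℂ := fun t => ⟪w, S.τHydro t (S.cls (N.fluct K) (N.fluct_mem K))⟫_ℂ with hg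
  have hgc : Continuous g := continuous_const.inner hcont
  have hgd := fun t => N.norm_inner_integral_pairCls_sub_coupling_le hcl hv.le (by linarith) I K t
    hL0
  -- At short times the superdiffusive bound is not available; clustering at bounded times gives a
  -- bound independent of `T`.
  have hsmall : ∀ t, |t| ≤ R → ‖g t - c‖ ≤ B := by
    intro t ht
    have hi := (integrable_conn3_shift hcl hv.le (by linarith) (N.q_mem I) (N.q_mem I)
      (N.fluct_mem K) 0 0 t).norm
    refine (hgd t).trans ((setIntegral_le_integral hi (ae_of_all _ fun z => norm_nonneg _)).trans
      (integral_mono hi hBi fun z => H' _ _ _ _ _ (by simpa using hR.le) (by simpa using hR.le) ht))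
  have hlarge : ∀ t, R ≤ |t| → |t| ≤ T → ‖g t - c‖ ≤ ‖c‖ / 4 := fun t h1 h2 =>
    (hgd t).trans ((hT t h1 h2).trans hεT.le)
  have hint : ∀ a b, IntervalIntegrable (fun t => g t - c) volume a b := fun a b =>
    (hgc.sub continuous_const).intervalIntegrable a b
  have e1 : ‖∫ t in (-T)..(-R), (g t - c)‖ ≤ ‖c‖ / 4 * |(-R) - (-T)| :=
    intervalIntegral.norm_integral_le_of_norm_le_const fun t ht => by
      rw [uIoc_of_le (by linarith)] at ht
      have : |t| = -t := abs_of_nonpos (by linarith [ht.2])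
      exact hlarge t (by linarith [ht.2]) (by linarith [ht.1])
  have e2 : ‖∫ t in (-R)..R, (g t - c)‖ ≤ B * |R - (-R)| :=
    intervalIntegral.norm_integral_le_of_norm_le_const fun t ht => by
      rw [uIoc_of_le (by linarith)] at ht
      exact hsmall t (abs_le.2 ⟨ht.1.le, ht.2⟩)
  have e3 : ‖∫ t in R..T, (g t - c)‖ ≤ ‖c‖ / 4 * |T - R| :=
    intervalIntegral.norm_integral_le_of_norm_le_const fun t ht => by
      rw [uIoc_of_le (by linarith)] at ht
      have : |t| = t := abs_of_nonneg (by linarith [ht.1])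
      exact hlarge t (by linarith [ht.1]) (by linarith [ht.2])
  have hsum : ∫ t in (-T)..T, (g t - c) = (∫ t in (-T)..(-R), (g t - c)) +
      (∫ t in (-R)..R, (g t - c)) + ∫ t in R..T, (g t - c) := by
    rw [intervalIntegral.integral_add_adjacent_intervals (hint _ _) (hint _ _),
      intervalIntegral.integral_add_adjacent_intervals (hint _ _) (hint _ _)]
  have htot : ‖∫ t in (-T)..T, (g t - c)‖ ≤ ‖c‖ * T := by
    rw [hsum]
    refine norm_add₃_le.trans ((add_le_add (add_le_add e1 e2) e3).trans ?_)
    rw [abs_of_nonneg (by linarith), abs_of_nonneg (by linarith), abs_of_nonneg (by linarith)]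
    rw [div_le_iff₀ hc0] at hBT
    nlinarith
  have hsplit : ∫ t in (-T)..T, (g t - c) = (∫ t in (-T)..T, g t) - (2 * T : ℝ) • c := by
    rw [intervalIntegral.integral_sub (hgc.intervalIntegrable _ _) intervalIntegrable_const,
      intervalIntegral.integral_const]
    congr 2
    ring
  rw [hsplit] at htot
  have hrev := norm_sub_norm_le ((2 * T : ℝ) • c) (∫ t in (-T)..T, g t)
  rw [norm_sub_rev, norm_smul, Real.norm_eq_abs, abs_of_pos (by linarith)] at hrev
  linarith

/-- Superdiffusive clustering and a nonzero coupling force a nonzero lower norm of the current. -/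
lemma SuperClustering.lowerNorm_ne_zero {I K : M} {α u : ℝ} (h : N.SuperClustering v I K α)
    (hcl : S.Clustering v p) (hv : 0 < v) (hp : 3 < p) (hα : α ∈ Ioo (1 / 2 : ℝ) 1)
    (hu : α + 1 < u) (hu' : u < 2) (hne : N.coupling I K ≠ 0) :
    S.lowerNorm u (N.current K) ≠ 0 := by
  obtain ⟨k, hk, H⟩ := h.exists_overlap_bound hcl hv hp hα hu hu' hne
  obtain ⟨D, hD, HD⟩ := N.exists_norm_integral_pairCls_sq_le hcl hv.le (by linarith) I
  have hc0 : 0 < ‖N.coupling I K‖ := norm_pos_iff.2 hne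
  -- `D + 1` replaces `D`, which may be zero, so that the quotient is meaningful.
  set b : ℝ := 2 ^ (u - 3) * (‖N.coupling I K‖ ^ 2 / ((D + 1) * (2 * k))) with hb
  have hb0 : 0 < b := by positivity
  have hlow : ∀ᶠ T : ℝ in atTop, b ≤
      (2 * T) ^ (u - 3) * ‖∫ t in (-T)..T, S.oneSubProj (S.τHydro t (N.current K))‖ ^ 2 := by
    filter_upwards [H, eventually_gt_atTop 0] with T hT hT0
    set J := ∫ t in (-T)..T, S.oneSubProj (S.τHydro t (N.current K)) with hJ
    set w := ∫ y in (-(2 * (k * T ^ (u - 1))))..(2 * (k * T ^ (u - 1))), N.pairCls I y with hw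
    have h1 : ‖N.coupling I K‖ * T ≤ ‖w‖ * ‖J‖ := hT.trans (norm_inner_le_norm w J)
    have h2 : ‖w‖ ^ 2 ≤ D * (2 * (k * T ^ (u - 1))) := HD _ (by positivity)
    have h3 : (‖N.coupling I K‖ * T) ^ 2 ≤ (D + 1) * (2 * k) * T ^ (u - 1) * ‖J‖ ^ 2 := by
      calc _ ≤ (‖w‖ * ‖J‖) ^ 2 := by gcongr
        _ = ‖w‖ ^ 2 * ‖J‖ ^ 2 := by ring
        _ ≤ D * (2 * (k * T ^ (u - 1))) * ‖J‖ ^ 2 := by gcongr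
        _ ≤ (D + 1) * (2 * (k * T ^ (u - 1))) * ‖J‖ ^ 2 := by gcongr; linarith
        _ = _ := by ring
    have h4 : T ^ (u - 3) * T ^ 2 = T ^ (u - 1) := by
      rw [← Real.rpow_natCast, ← Real.rpow_add hT0]; congr 1; push_cast; ring
    have hTu : 0 < T ^ (u - 1) := by positivity
    have h5 : ‖N.coupling I K‖ ^ 2 * T ^ 2 ≤ (D + 1) * (2 * k) * (T ^ (u - 3) * ‖J‖ ^ 2) * T ^ 2 := by
      calc _ = (‖N.coupling I K‖ * T) ^ 2 := by ring
        _ ≤ _ := h3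
        _ = _ := by rw [← h4]; ring
    have h6 := le_of_mul_le_mul_right h5 (by positivity)
    rw [Real.mul_rpow (by norm_num) hT0.le, mul_assoc, hb]
    gcongr
    rw [div_le_iff₀ (by positivity)]
    linarith
  rw [lowerNorm]
  have hlim : ENNReal.ofReal b ≤ liminf (fun T : ℝ => ENNReal.ofReal
      ((2 * T) ^ (u - 3) * ‖∫ t in (-T)..T, S.oneSubProj (S.τHydro t (N.current K))‖ ^ 2))
      atTop :=
    le_liminf_of_le (by isBoundedDefault) (hlow.mono fun T hT => ENNReal.ofReal_le_ofReal hT)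
  have hpos : 0 < liminf (fun T : ℝ => ENNReal.ofReal
      ((2 * T) ^ (u - 3) * ‖∫ t in (-T)..T, S.oneSubProj (S.τHydro t (N.current K))‖ ^ 2))
      atTop := (ENNReal.ofReal_pos.2 hb0).trans_le hlim
  rw [Ne, ENNReal.rpow_eq_zero_iff_of_pos (by norm_num), mul_eq_zero, not_or]
  exact ⟨(ENNReal.ofReal_pos.2 (by linarith)).ne', hpos.ne'⟩

/-! ### From the lower norm to the exponents -/

lemma SuperClustering.le_of_lowerNorm_eq_zero {I K : M} {α d : ℝ}
    (h : N.SuperClustering v I K α) (hcl : S.Clustering v p) (hv : 0 < v) (hp : 3 < p)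
    (hα : α ∈ Ioo (1 / 2 : ℝ) 1) (hne : N.coupling I K ≠ 0) (hd : d < 2)
    (hzero : ∀ u ∈ Ioo (1 : ℝ) 2, u < d → S.lowerNorm u (N.current K) = 0) : d ≤ α + 1 := by
  by_contra! hlt
  -- At an order strictly between `α + 1` and `d` the lower norm would be both zero and nonzero.
  obtain ⟨u, hu1, hu2⟩ := exists_between hlt
  exact h.lowerNorm_ne_zero hcl hv hp hα hu1 (hu2.trans hd) hne
    (hzero u ⟨by linarith [hα.1], hu2.trans hd⟩ hu2)

lemma SuperClustering.le_of_hasNormalExponent {I K : M} {α αK : ℝ}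
    (h : N.SuperClustering v I K α) (hcl : S.Clustering v p) (hv : 0 < v) (hp : 3 < p)
    (hα : α ∈ Ioo (1 / 2 : ℝ) 1) (hne : N.coupling I K ≠ 0)
    (hK : S.HasNormalExponent (N.current K) αK) : 1 - α / 2 ≤ αK := by
  have := h.le_of_lowerNorm_eq_zero hcl hv hp hα hne (d := 3 - 2 * αK) (by linarith [hK.1.1])
    fun u hu => (hK.2 u hu).1
  linarith

lemma SuperClustering.le_of_hasFatExponent {I K : M} {α αK : ℝ}
    (h : N.SuperClustering v I K α) (hcl : S.Clustering v p) (hv : 0 < v) (hp : 3 < p)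
    (hα : α ∈ Ioo (1 / 2 : ℝ) 1) (hne : N.coupling I K ≠ 0)
    (hK : S.HasFatExponent (N.current K) αK) : 1 / (α + 1) ≤ αK := by
  have hK0 : 0 < αK := by linarith [hK.1.1]
  have := h.le_of_lowerNorm_eq_zero hcl hv hp hα hne (d := 1 / αK)
    (by rw [div_lt_iff₀ hK0]; linarith [hK.1.1]) fun u hu => (hK.2 u hu).1
  exact (one_div_le hK0 (by linarith [hα.1])).1 this

end ManyBodySystem.NormalModes

theorem mainTheorem3 {𝔄 : Type*} [Ring 𝔄] [StarRing 𝔄] [Algebra ℂ 𝔄] [StarModule ℂ 𝔄]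
    (S : ManyBodySystem 𝔄) {M : Type*} (N : S.NormalModes M)
    (v p : ℝ) (hv : 0 < v) (hp : 3 < p) (hcl : S.Clustering v p)
    (I : M) (αI : ℝ) (hα : αI ∈ Set.Ioo (1 / 2 : ℝ) 1) :
    (N.SuperClustering v I I αI → N.coupling I I ≠ 0 →
      (S.HasNormalExponent (N.current I) αI → 2 / 3 ≤ αI) ∧
      (S.HasFatExponent (N.current I) αI → 2 / (√5 + 1) ≤ αI)) ∧
    (∀ (K : M) (αK : ℝ), N.SuperClustering v I K αI → N.coupling I K ≠ 0 →
      (S.HasNormalExponent (N.current K) αK → 1 - αI / 2 ≤ αK) ∧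
      (S.HasFatExponent (N.current K) αK → 1 / (αI + 1) ≤ αK)) := by
  refine ⟨fun h hne => ⟨fun hI => ?_, fun hI => ?_⟩, fun K αK h hne =>
    ⟨h.le_of_hasNormalExponent hcl hv hp hα hne, h.le_of_hasFatExponent hcl hv hp hα hne⟩⟩
  · linarith [h.le_of_hasNormalExponent hcl hv hp hα hne hI]
  · have h1 := h.le_of_hasFatExponent hcl hv hp hα hne hI
    have hα0 : 0 < αI := by linarith [hα.1]
    rw [div_le_iff₀ (by linarith)] at h1
    rw [div_le_iff₀ (by positivity)]
    -- The bound reads `1 ≤ αI * (αI + 1)`, and `2 / (√5 + 1)` is the positive root of `x ^ 2 + x =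
    -- 1`.
    have h5 : √5 ^ 2 = 5 := Real.sq_sqrt (by norm_num)
    have h5' := Real.sqrt_nonneg 5
    by_contra! hlt
    nlinarith
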